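/- Let $k$ be an algebraically closed field, $n\ge 1$, and let $q=(q_{ij})$ be an $n\times n$ matrix with entries in $k^\times$ such that $q_{ii}=1$ and $q_{ij}=q_{ji}^{-1}$ for all $i,j$; assume that all $q_{ij}$ are roots of unity. Let $R=k_q[[x_1,\dots,x_n]]$ be the $k$-algebra of formal power series $\sum_{s\in\mathbb N^n}c_s x^s$, where $c_s\in k$ and $x^s=x_1^{s_1}\cdots x_n^{s_n}$, with multiplication determined by $x_ix_j=q_{ij}x_jx_i$. Put $\sigma(s,t)=\prod_{i,j=1}^n q_{ij}^{s_it_j}$ for $s,t\in\mathbb Z^n$ and $S=\{s\in\mathbb Z^n : \sigma(s,t)=1 \text{ for all } t\in\mathbb Z^n\}$, a subgroup of $\mathbb Z^n$. Assume that $S$ has a positive diagonal basis, that is, a $\mathbb Z$-basis $b_1,\dots,b_n$ such that the matrix with rows $b_1,\dots,b_n$ is diagonal with positive diagonal entries. Then $R$ is a unique factorization ring (UFR) in the sense of Chatters and Jordan: $R$ is a (left and right) noetherian prime ring, and every height-one prime ideal $P$ of $R$ is principal, i.e. $P=pR=Rp$ for some $p\in P$. (Here a prime ideal is a proper two-sided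 ideal $P$ such that $aRb\subseteq P$ implies $a\in P$ or $b\in P$.) Moreover, $R$ is a domain; it is a local ring whose set of non-units is the two-sided ideal $J=\langle x_1,\dots,x_n\rangle$; it is separated and complete in the $J$-adic topology; it is a PI algebra over $k$, i.e. some nonzero noncommutative polynomial over $k$ vanishes on $R$; and $R$ is noncommutative whenever some $q_{ij}\ne 1$. -/

import Mathlib

noncomputable section

/-- `(q i j)` is multiplicatively antisymmetric: `q i i = 1` and `q i j = (q j i)⁻¹`. -/
def IsMulAntisymm {k : Type*} [Field k] {n : ℕ} (q : Fin n → Fin n → kˣ) : Prop :=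
  (∀ i, q i i = 1) ∧ ∀ i j, q i j = (q j i)⁻¹

/-- The scalar `c(s,t)` with `x^s x^t = c(s,t) x^(s+t)`, where `x^s = x₁^(s₁) ⋯ xₙ^(sₙ)` and
`xᵢ xⱼ = qᵢⱼ xⱼ xᵢ`: each `xⱼ` of `x^t` moves to the left past the `xᵢ` of `x^s` with `j < i`. -/
def qCocycle {k : Type*} [Field k] {n : ℕ} (q : Fin n → Fin n → kˣ)
    (s t : Fin n →₀ ℕ) : kˣ :=
  ∏ i, ∏ j with j < i, q i j ^ (s i * t j)

theorem qCocycle_zero_left {k : Type*} [Field k] {n : ℕ} (q : Fin n → Fin n → kˣ)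
    (t : Fin n →₀ ℕ) : qCocycle q 0 t = 1 := by
  simp [qCocycle]

theorem qCocycle_zero_right {k : Type*} [Field k] {n : ℕ} (q : Fin n → Fin n → kˣ)
    (s : Fin n →₀ ℕ) : qCocycle q s 0 = 1 := by
  simp [qCocycle]

theorem qCocycle_add_left {k : Type*} [Field k] {n : ℕ} (q : Fin n → Fin n → kˣ)
    (s t u : Fin n →₀ ℕ) : qCocycle q (s + t) u = qCocycle q s u * qCocycle q t u := by
  simp only [qCocycle, ← Finset.prod_mul_distrib, ← pow_add, ← add_mul, Finsupp.add_apply]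

theorem qCocycle_add_right {k : Type*} [Field k] {n : ℕ} (q : Fin n → Fin n → kˣ)
    (s t u : Fin n →₀ ℕ) : qCocycle q s (t + u) = qCocycle q s t * qCocycle q s u := by
  simp only [qCocycle, ← Finset.prod_mul_distrib, ← pow_add, ← mul_add, Finsupp.add_apply]

/-- The `q`-commutative power series ring `k_q[[x₁,…,xₙ]]`: the formal series
`∑ c_s x^s`, `s ∈ ℕⁿ`, stored as their coefficient families. -/
def QPowerSeries {k : Type*} [Field k] {n : ℕ} (_q : Fin n → Fin n → kˣ) : Type _ :=
  (Fin n →₀ ℕ) → k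

namespace QPowerSeries

variable {k : Type*} [Field k] {n : ℕ} {q : Fin n → Fin n → kˣ}

instance : AddCommGroup (QPowerSeries q) :=
  inferInstanceAs (AddCommGroup ((Fin n →₀ ℕ) → k))

/-- The coefficient of `x^s`. -/
def coeff (s : Fin n →₀ ℕ) (f : QPowerSeries q) : k := f s

@[ext] theorem ext {f g : QPowerSeries q} (h : ∀ s, coeff s f = coeff s g) : f = g := funext h

/-- The series `a x^s`. -/
def monomial (s : Fin n →₀ ℕ) (a : k) : QPowerSeries q := fun t => if t = s then a else 0

/-- The indeterminate `xᵢ`. -/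
def X (q : Fin n → Fin n → kˣ) (i : Fin n) : QPowerSeries q := monomial (Finsupp.single i 1) 1

instance : One (QPowerSeries q) := ⟨monomial 0 1⟩

/-- Multiplication extends `x^s x^t = c(s,t) x^(s+t)` to formal series. -/
instance : Mul (QPowerSeries q) :=
  ⟨fun f g u => ∑ p ∈ Finset.HasAntidiagonal.antidiagonal u, (qCocycle q p.1 p.2 : k) * (f p.1 * g p.2)⟩

theorem coeff_zero (s : Fin n →₀ ℕ) : coeff s (0 : QPowerSeries q) = 0 := rfl

theorem coeff_add (s : Fin n →₀ ℕ) (f g : QPowerSeries q) :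
    coeff s (f + g) = coeff s f + coeff s g := rfl

theorem coeff_monomial (s t : Fin n →₀ ℕ) (a : k) :
    coeff t (monomial s a : QPowerSeries q) = if t = s then a else 0 := rfl

theorem coeff_one (s : Fin n →₀ ℕ) :
    coeff s (1 : QPowerSeries q) = if s = 0 then 1 else 0 := rfl

theorem coeff_mul (u : Fin n →₀ ℕ) (f g : QPowerSeries q) :
    coeff u (f * g) = ∑ p ∈ Finset.HasAntidiagonal.antidiagonal u,
      (qCocycle q p.1 p.2 : k) * (coeff p.1 f * coeff p.2 g) := rfl

theorem coeff_monomial_zero_mul (a : k) (s : Fin n →₀ ℕ) (f : QPowerSeries q) :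
    coeff s (monomial 0 a * f) = a * coeff s f := by
  rw [coeff_mul, Finset.sum_eq_single (0, s)]
  · simp [coeff_monomial, qCocycle_zero_left]
  · rintro ⟨a, b⟩ hab hne
    rw [Finset.HasAntidiagonal.mem_antidiagonal] at hab
    rw [coeff_monomial, if_neg]
    · simp
    · rintro rfl
      simp_all
  · simp

theorem coeff_mul_monomial_zero (a : k) (s : Fin n →₀ ℕ) (f : QPowerSeries q) :
    coeff s (f * monomial 0 a) = coeff s f * a := by
  rw [coeff_mul, Finset.sum_eq_single (s, 0)]
  · simp [coeff_monomial, qCocycle_zero_right]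
  · rintro ⟨a, b⟩ hab hne
    rw [Finset.HasAntidiagonal.mem_antidiagonal] at hab
    rw [coeff_monomial, if_neg]
    · simp
    · rintro rfl
      simp_all
  · simp

instance : Ring (QPowerSeries q) :=
  { (inferInstance : AddCommGroup (QPowerSeries q)),
    (inferInstance : One (QPowerSeries q)),
    (inferInstance : Mul (QPowerSeries q)) with
    left_distrib := fun f g h => by
      ext s
      simp only [coeff_mul, coeff_add, mul_add, Finset.sum_add_distrib]
    right_distrib := fun f g h => by
      ext s
      simp only [coeff_mul, coeff_add, add_mul, mul_add, Finset.sum_add_distrib]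
    zero_mul := fun f => by
      ext s
      simp [coeff_mul, coeff_zero]
    mul_zero := fun f => by
      ext s
      simp [coeff_mul, coeff_zero]
    one_mul := fun f => by
      ext s
      exact (coeff_monomial_zero_mul 1 s f).trans (one_mul _)
    mul_one := fun f => by
      ext s
      exact (coeff_mul_monomial_zero 1 s f).trans (mul_one _)
    mul_assoc := fun f g h => by
      ext u
      simp only [coeff_mul, Finset.mul_sum, Finset.sum_mul, Finset.sum_sigma']
      apply Finset.sum_nbij' (fun ⟨⟨_i, j⟩, ⟨k, l⟩⟩ ↦ ⟨(k, l + j), (l, j)⟩)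
        (fun ⟨⟨i, _j⟩, ⟨k, l⟩⟩ ↦ ⟨(i + k, l), (i, k)⟩)
      · rintro ⟨⟨i, j⟩, ⟨a, b⟩⟩ hp
        simp only [Finset.mem_sigma, Finset.HasAntidiagonal.mem_antidiagonal] at hp ⊢
        obtain ⟨rfl, rfl⟩ := hp
        simp [add_assoc]
      · rintro ⟨⟨i, j⟩, ⟨a, b⟩⟩ hp
        simp only [Finset.mem_sigma, Finset.HasAntidiagonal.mem_antidiagonal] at hp ⊢
        obtain ⟨rfl, rfl⟩ := hp
        simp [add_assoc]
      · rintro ⟨⟨i, j⟩, ⟨a, b⟩⟩ hp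
        simp only [Finset.mem_sigma, Finset.HasAntidiagonal.mem_antidiagonal] at hp
        obtain ⟨_, rfl⟩ := hp
        rfl
      · rintro ⟨⟨i, j⟩, ⟨a, b⟩⟩ hp
        simp only [Finset.mem_sigma, Finset.HasAntidiagonal.mem_antidiagonal] at hp
        obtain ⟨_, rfl⟩ := hp
        rfl
      · rintro ⟨⟨i, j⟩, ⟨a, b⟩⟩ hp
        simp only [Finset.mem_sigma, Finset.HasAntidiagonal.mem_antidiagonal] at hp
        obtain ⟨_, rfl⟩ := hp
        simp only [qCocycle_add_left, qCocycle_add_right, Units.val_mul]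
        ring }

/-- The scalar `a ∈ k` acts as the constant series `a`. -/
instance : Algebra k (QPowerSeries q) :=
  RingHom.toAlgebra'
    { toFun := fun a => monomial 0 a
      map_one' := rfl
      map_mul' := fun a b => by
        ext s
        rw [coeff_monomial_zero_mul, coeff_monomial, coeff_monomial, mul_ite, mul_zero]
      map_zero' := by
        ext s
        simp [coeff_monomial, coeff_zero]
      map_add' := fun a b => by
        ext s
        by_cases h : s = 0 <;> simp [coeff_monomial, coeff_add, h] }
    (fun a f => by
      ext s
      exact (coeff_monomial_zero_mul a s f).trans
        ((mul_comm _ _).trans (coeff_mul_monomial_zero a s f).symm))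

/-- The augmentation ideal `J = ⟨x₁,…,xₙ⟩`. -/
def augIdeal (q : Fin n → Fin n → kˣ) : TwoSidedIdeal (QPowerSeries q) :=
  TwoSidedIdeal.span (Set.range (X q))

end QPowerSeries

/-- The alternating bicharacter `σ(s,t) = ∏ q_{ij}^{s_i t_j}` on `ℤⁿ × ℤⁿ`. -/
def qBicharacter {k : Type*} [Field k] {n : ℕ} (q : Fin n → Fin n → kˣ)
    (s t : Fin n → ℤ) : kˣ :=
  ∏ i, ∏ j, q i j ^ (s i * t j)

/-- The subgroup `S = {s ∈ ℤⁿ | σ(s,t) = 1 for all t ∈ ℤⁿ}`. -/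
def qRadical {k : Type*} [Field k] {n : ℕ} (q : Fin n → Fin n → kˣ) :
    AddSubgroup (Fin n → ℤ) where
  carrier := {s | ∀ t, qBicharacter q s t = 1}
  zero_mem' := fun t => by simp [qBicharacter]
  add_mem' := fun {a b} ha hb t => by
    have h : qBicharacter q (a + b) t = qBicharacter q a t * qBicharacter q b t := by
      simp only [qBicharacter, ← Finset.prod_mul_distrib, ← zpow_add, ← add_mul, Pi.add_apply]
    rw [h, ha t, hb t, one_mul]
  neg_mem' := fun {a} ha t => by
    have h : qBicharacter q (-a) t = (qBicharacter q a t)⁻¹ := by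
      simp only [qBicharacter, ← Finset.prod_inv_distrib, ← zpow_neg, neg_mul, Pi.neg_apply]
    rw [h, ha t, inv_one]

/-- A `ℤ`-basis `b₁,…,bₙ` of a subgroup of `ℤⁿ` is positive diagonal if the matrix with rows
`b₁,…,bₙ` is diagonal with positive diagonal entries. -/
def IsPositiveDiagonal {n : ℕ} {S : AddSubgroup (Fin n → ℤ)}
    (b : Module.Basis (Fin n) ℤ S) : Prop :=
  (∀ i j, i ≠ j → (b i : Fin n → ℤ) j = 0) ∧ ∀ i, 0 < (b i : Fin n → ℤ) i

/-- Prime ideals of a (not necessarily commutative) ring: proper two-sided ideals `P` such that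
`a R b ⊆ P` implies `a ∈ P` or `b ∈ P`. -/
def IsPrimeTwoSided {R : Type*} [Ring R] (P : TwoSidedIdeal R) : Prop :=
  P ≠ ⊤ ∧ ∀ a b : R, (∀ r : R, a * r * b ∈ P) → a ∈ P ∨ b ∈ P

/-- Height-one prime ideals; the height is taken in the poset of all prime ideals. -/
def IsHeightOnePrime {R : Type*} [Ring R] (P : TwoSidedIdeal R) : Prop :=
  ∃ hP : IsPrimeTwoSided P,
    Order.height (⟨P, hP⟩ : {Q : TwoSidedIdeal R // IsPrimeTwoSided Q}) = 1

/-- A two-sided ideal `P` is principal if `P = pR = Rp` for a single element `p`. -/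
def IsPrincipalTwoSided {R : Type*} [Ring R] (P : TwoSidedIdeal R) : Prop :=
  ∃ p : R, (∀ x, x ∈ P ↔ ∃ r, x = p * r) ∧ ∀ x, x ∈ P ↔ ∃ r, x = r * p

/-- Unique factorization rings in the sense of Chatters and Jordan: (left and right) noetherian
prime rings in which every height-one prime ideal is principal. -/
structure IsUFR (R : Type*) [Ring R] : Prop where
  left_noetherian : IsNoetherianRing R
  right_noetherian : IsNoetherianRing Rᵐᵒᵖ
  prime : IsPrimeTwoSided (⊥ : TwoSidedIdeal R)
  principal : ∀ P : TwoSidedIdeal R, IsHeightOnePrime P → IsPrincipalTwoSided P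

/-- `R` is separated and complete in the `J`-adic topology. -/
def IsSeparatedComplete {R : Type*} [Ring R] (J : TwoSidedIdeal R) : Prop :=
  (∀ x : R, (∀ m : ℕ, x ∈ J.asIdeal ^ m) → x = 0) ∧
  ∀ f : ℕ → R, (∀ m : ℕ, ∃ N, ∀ a ≥ N, ∀ b ≥ N, f a - f b ∈ J.asIdeal ^ m) →
    ∃ L : R, ∀ m : ℕ, ∃ N, ∀ a ≥ N, f a - L ∈ J.asIdeal ^ m

/-- A `k`-algebra is a PI algebra if some nonzero noncommutative polynomial over `k` vanishes
under all substitutions of elements of the algebra. -/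
def IsPIAlgebra (k A : Type*) [Field k] [Ring A] [Algebra k A] : Prop :=
  ∃ f : FreeAlgebra k ℕ, f ≠ 0 ∧ ∀ a : ℕ → A, FreeAlgebra.lift k a f = 0

end

/-! A positive diagonal basis says that `S = ⊕ dᵢℤ`, so a monomial `x^s` is central exactly when
every `dᵢ` divides `sᵢ`. The commutative power series ring `Z = k[[x₁^(d₁),…,xₙ^(dₙ)]]` is therefore
central in `R`, and `R` is free over `Z` on the finitely many `x^r` with `0 ≤ rᵢ < dᵢ`
(`componentEquiv`). Finiteness over `Z` makes `R` noetherian on both sides, and a standard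
polynomial of degree above the rank vanishes on `R`. Lexicographically least terms multiply to a
nonzero term, so `R` is a domain. A series is a unit iff its constant term is nonzero, and `J^m`
consists of the series with no term of degree below `m`; this gives locality and completeness.

For a height-one prime `P` it suffices to find a nonzero prime ideal `pR = Rp` inside `P`. If `P`
contains some `xᵢ`, take `p = xᵢ`: the quotient `R/xᵢR` has no zero divisors.

Suppose `P` contains no `xᵢ`. Since `xᵢ` is normal, `P` is stable under conjugation by `xᵢ`, which
multiplies each monomial by a `dᵢ`-th root of unity. Interpolation on these finitely many
eigenvalues shows that `P` contains the isotypic parts of its elements (`isotypic_mem`). A monomial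
multiple of an isotypic part is central, so `P ∩ Z ≠ 0`. As `Z` is factorial, the prime ideal `P ∩
Z` contains a prime `p` of `Z`, and `p` divides no `xᵢ^(dᵢ)`. The same isotypic argument, applied to
the ideal of all `a` with `aRb ⊆ pR`, shows that `pR` is prime (`isPrimeTwoSided_centralIdeal`).

Factoriality of `Z` goes by induction on the number of variables: after a linear change of
variables, available over an infinite field, Weierstrass preparation replaces a series by a
polynomial over the ring in one variable less, and Gauss's lemma applies. -/

open Finset.HasAntidiagonal in
theorem Finsupp.fst_ne_of_mem_antidiagonal {ι : Type*} [DecidableEq ι] (u s : ι →₀ ℕ)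
    (h : s ≤ u) : ∀ p ∈ antidiagonal u, p ≠ (s, u - s) → p.1 ≠ s := by
  rintro ⟨a, b⟩ hp hne rfl
  rw [mem_antidiagonal] at hp
  simp only at hp
  apply hne
  rw [← hp]
  simp

/-! ### Monomials, twists and absence of zero divisors -/

noncomputable section

namespace QPowerSeries

variable {k : Type*} [Field k] {n : ℕ} {q : Fin n → Fin n → kˣ}

/-- The series with given coefficients. -/
def mk (c : (Fin n →₀ ℕ) → k) : QPowerSeries q := c

theorem coeff_mk (c : (Fin n →₀ ℕ) → k) (s : Fin n →₀ ℕ) :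
    coeff s (mk c : QPowerSeries q) = c s := rfl

theorem coeff_sub (s : Fin n →₀ ℕ) (f g : QPowerSeries q) :
    coeff s (f - g) = coeff s f - coeff s g := rfl

theorem coeff_neg (s : Fin n →₀ ℕ) (f : QPowerSeries q) :
    coeff s (-f) = - coeff s f := rfl

theorem coeff_sum {ι : Type*} (s : Fin n →₀ ℕ) (t : Finset ι) (f : ι → QPowerSeries q) :
    coeff s (∑ i ∈ t, f i) = ∑ i ∈ t, coeff s (f i) :=
  map_sum (⟨⟨coeff s, coeff_zero s⟩, coeff_add s⟩ : QPowerSeries q →+ k) f t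

theorem ne_zero_iff {f : QPowerSeries q} : f ≠ 0 ↔ ∃ s, coeff s f ≠ 0 := by
  refine ⟨fun h => ?_, fun ⟨s, hs⟩ h => hs (by rw [h, coeff_zero])⟩
  by_contra! h'
  exact h (ext h')

theorem coeff_monomial_mul (u s : Fin n →₀ ℕ) (a : k) (f : QPowerSeries q) :
    coeff u (monomial s a * f) =
      if s ≤ u then (qCocycle q s (u - s) : k) * (a * coeff (u - s) f) else 0 := by
  rw [coeff_mul]
  split_ifs with h
  · rw [Finset.sum_eq_single (s, u - s)]
    · simp [coeff_monomial]
    · intro p hp hne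
      rw [coeff_monomial, if_neg (Finsupp.fst_ne_of_mem_antidiagonal u s h p hp hne)]
      simp
    · intro hp
      simp [h] at hp
  · refine Finset.sum_eq_zero fun p hp => ?_
    rw [coeff_monomial, if_neg]
    · simp
    · rintro rfl
      rw [Finset.HasAntidiagonal.mem_antidiagonal] at hp
      exact h (hp ▸ le_self_add)

theorem coeff_mul_monomial (u s : Fin n →₀ ℕ) (a : k) (f : QPowerSeries q) :
    coeff u (f * monomial s a) =
      if s ≤ u then (qCocycle q (u - s) s : k) * (coeff (u - s) f * a) else 0 := by
  rw [coeff_mul, ← Finset.sum_equiv (Equiv.prodComm _ _)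
    (s := Finset.HasAntidiagonal.antidiagonal u)
    (f := fun p => (qCocycle q p.2 p.1 : k) * (coeff p.2 f * coeff p.1 (monomial s a : QPowerSeries q)))
    (by simp [add_comm]) (fun _ _ => rfl)]
  split_ifs with h
  · rw [Finset.sum_eq_single (s, u - s)]
    · simp [coeff_monomial]
    · intro p hp hne
      rw [coeff_monomial, if_neg (Finsupp.fst_ne_of_mem_antidiagonal u s h p hp hne)]
      simp
    · intro hp
      simp [h] at hp
  · refine Finset.sum_eq_zero fun p hp => ?_
    rw [coeff_monomial, if_neg]
    · simp
    · rintro rfl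
      rw [Finset.HasAntidiagonal.mem_antidiagonal] at hp
      exact h (hp ▸ le_self_add)

theorem monomial_mul_monomial (s t : Fin n →₀ ℕ) (a b : k) :
    (monomial s a * monomial t b : QPowerSeries q) =
      monomial (s + t) (qCocycle q s t * (a * b)) := by
  ext u
  rw [coeff_monomial_mul]
  simp only [coeff_monomial]
  split_ifs with h1 h2 h3 h3 h4
  · rw [h2]
  · exact absurd (by rw [← h2, add_tsub_cancel_of_le h1]) h3
  · exact absurd (by rw [h3, add_tsub_cancel_left]) h2
  · simp
  · exact absurd (h4 ▸ le_self_add) h1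
  · rfl

/-- Multiply the coefficient of `x^s` by `w s`. -/
def twist (w : (Fin n →₀ ℕ) → k) (f : QPowerSeries q) : QPowerSeries q :=
  mk fun s => w s * coeff s f

theorem coeff_twist (w : (Fin n →₀ ℕ) → k) (f : QPowerSeries q) (s : Fin n →₀ ℕ) :
    coeff s (twist w f) = w s * coeff s f := rfl

/-- The scalar `χ` with `x^s x^t = χ x^t x^s`. -/
def commutator (q : Fin n → Fin n → kˣ) (s t : Fin n →₀ ℕ) : kˣ :=
  qCocycle q s t / qCocycle q t s

theorem commutator_add_right (s t u : Fin n →₀ ℕ) :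
    commutator q s (t + u) = commutator q s t * commutator q s u := by
  simp only [commutator, qCocycle_add_left, qCocycle_add_right]
  exact mul_div_mul_comm _ _ _ _

/-- Monomials are normal elements: moving one across a series only rescales coefficients by a
character of the exponent. Conjugation by `xᵢ` is thus a twist, which is how it enters the study of
ideals. -/
theorem monomial_mul_eq (s : Fin n →₀ ℕ) (a : k) (f : QPowerSeries q) :
    monomial s a * f = twist (fun t => (commutator q s t : k)) f * monomial s a := by
  ext u
  rw [coeff_monomial_mul, coeff_mul_monomial, coeff_twist]
  congr 1
  have := (qCocycle q (u - s) s).ne_zero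
  simp only [commutator, Units.val_div_eq_div_val]
  field_simp

theorem mul_monomial_eq (s : Fin n →₀ ℕ) (a : k) (f : QPowerSeries q) :
    f * monomial s a =
      monomial s a * twist (fun t => (commutator q s t : k)⁻¹) f := by
  rw [monomial_mul_eq]
  congr 1
  ext u
  simp [coeff_twist]

/-- A product has a nonzero coefficient on a face of `ℕⁿ` when both factors have. -/
theorem exists_coeff_mul_ne_zero {F : (Fin n →₀ ℕ) → Prop} (hF : ∀ s t, F (s + t) ↔ F s ∧ F t)
    {f g : QPowerSeries q} (hf : ∃ s, F s ∧ coeff s f ≠ 0) (hg : ∃ s, F s ∧ coeff s g ≠ 0) :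
    ∃ s, F s ∧ coeff s (f * g) ≠ 0 := by
  have key : ∀ f : QPowerSeries q, (∃ s, F s ∧ coeff s f ≠ 0) →
      ∃ s, (F s ∧ coeff s f ≠ 0) ∧ ∀ t, F t → coeff t f ≠ 0 → toLex s ≤ toLex t := by
    rintro f ⟨s, hs⟩
    obtain ⟨m, hm, hmin⟩ := (wellFounded_lt : WellFounded
      (α := Lex (Fin n →₀ ℕ)) (· < ·)).has_min {s | F (ofLex s) ∧ coeff (ofLex s) f ≠ 0}
      ⟨toLex s, hs⟩
    exact ⟨ofLex m, hm, fun t ht ht' => not_lt.1 (hmin (toLex t) ⟨ht, ht'⟩)⟩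
  -- With `s` and `t` lexicographically least in the supports on the face, only the pair `(s, t)`
  -- contributes to the coefficient at `s + t`. The full `ℕⁿ` gives the domain property, the face
  -- `sᵢ = 0` the primeness of `xᵢR`.
  obtain ⟨s, ⟨hs, hs'⟩, hsmin⟩ := key f hf
  obtain ⟨t, ⟨ht, ht'⟩, htmin⟩ := key g hg
  refine ⟨s + t, (hF s t).2 ⟨hs, ht⟩, ?_⟩
  rw [coeff_mul, Finset.sum_eq_single (s, t)]
  · exact mul_ne_zero (Units.ne_zero _) (mul_ne_zero hs' ht')
  · rintro ⟨a, b⟩ hab hne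
    rw [Finset.HasAntidiagonal.mem_antidiagonal] at hab
    simp only at hab ⊢
    obtain ⟨ha, hb⟩ := (hF a b).1 (hab ▸ (hF s t).2 ⟨hs, ht⟩)
    by_contra h
    have h1 := hsmin a ha fun h' => h (by rw [h']; simp)
    have h2 := htmin b hb fun h' => h (by rw [h']; simp)
    have h3 : toLex a + toLex b = toLex s + toLex t := by rw [← toLex_add, hab, toLex_add]
    have h4 : toLex s = toLex a := by
      refine le_antisymm h1 ?_
      by_contra! h5
      exact (add_lt_add_of_lt_of_le h5 h2).ne h3.symm
    have h5 : s = a := toLex.injective h4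
    subst h5
    exact hne (by rw [add_left_cancel hab])
  · simp

instance : Nontrivial (QPowerSeries q) :=
  ⟨1, 0, ne_zero_iff.2 ⟨0, by rw [coeff_one]; simp⟩⟩

instance : IsDomain (QPowerSeries q) :=
  have : NoZeroDivisors (QPowerSeries q) := ⟨fun {f g} h => by
    by_contra! h'
    obtain ⟨s, -, hs⟩ := exists_coeff_mul_ne_zero (F := fun _ => True) (by simp)
      (by simpa using ne_zero_iff.1 h'.1) (by simpa using ne_zero_iff.1 h'.2)
    exact hs (by rw [h, coeff_zero])⟩
  NoZeroDivisors.to_isDomain _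

theorem isPrimeTwoSided_bot : IsPrimeTwoSided (⊥ : TwoSidedIdeal (QPowerSeries q)) := by
  refine ⟨fun h => ?_, fun a b h => ?_⟩
  · have : (1 : QPowerSeries q) ∈ (⊥ : TwoSidedIdeal (QPowerSeries q)) := h ▸ trivial
    exact one_ne_zero ((TwoSidedIdeal.mem_bot _).1 this)
  · have := (TwoSidedIdeal.mem_bot _).1 (h 1)
    simpa [TwoSidedIdeal.mem_bot] using this

/-! ### Units -/

theorem coeff_zero_mul (f g : QPowerSeries q) :
    coeff 0 (f * g) = coeff 0 f * coeff 0 g := by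
  rw [coeff_mul]
  simp [qCocycle_zero_left]

/-- The coefficients of a right inverse of `f`. -/
def invCoeff (f : QPowerSeries q) : (Fin n →₀ ℕ) → k
  | u =>
    if u = 0 then (coeff 0 f)⁻¹
    else -(coeff 0 f)⁻¹ * ∑ p ∈ Finset.HasAntidiagonal.antidiagonal u,
      -- The guard drops only the pair `(0, u)` and provides the decrease needed for the recursion.
      if _ : p.2 < u then (qCocycle q p.1 p.2 : k) * (coeff p.1 f * invCoeff f p.2) else 0
termination_by u => u

theorem exists_mul_eq_one {f : QPowerSeries q} (hf : coeff 0 f ≠ 0) :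
    ∃ g : QPowerSeries q, f * g = 1 := by
  refine ⟨mk (invCoeff f), ?_⟩
  ext u
  by_cases hu : u = 0
  · subst hu
    rw [coeff_zero_mul, coeff_one, if_pos rfl]
    rw [coeff_mk, invCoeff, if_pos rfl, mul_inv_cancel₀ hf]
  · rw [coeff_mul, coeff_one, if_neg hu,
      ← Finset.add_sum_erase _ _ (show (0, u) ∈ Finset.HasAntidiagonal.antidiagonal u by simp)]
    simp only [coeff_mk]
    rw [invCoeff, if_neg hu,
      ← Finset.add_sum_erase _ _ (show (0, u) ∈ Finset.HasAntidiagonal.antidiagonal u by simp)]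
    simp only [lt_self_iff_false, dite_false, zero_add, qCocycle_zero_left, Units.val_one, one_mul]
    rw [neg_mul, mul_neg, ← mul_assoc, mul_inv_cancel₀ hf, one_mul, neg_add_eq_zero]
    refine Finset.sum_congr rfl ?_
    rintro ⟨a, b⟩ hab
    rw [Finset.mem_erase, Finset.HasAntidiagonal.mem_antidiagonal] at hab
    rw [dif_pos]
    obtain ⟨h1, h2⟩ := hab
    simp only at h2 ⊢
    refine lt_of_le_of_ne (h2 ▸ le_add_self) ?_
    rintro rfl
    exact h1 (by simpa using h2)

theorem isUnit_iff {f : QPowerSeries q} : IsUnit f ↔ coeff 0 f ≠ 0 := by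
  constructor
  · rintro ⟨u, rfl⟩ h
    have := coeff_zero_mul (u : QPowerSeries q) (↑u⁻¹ : QPowerSeries q)
    rw [Units.mul_inv, h, coeff_one] at this
    simp at this
  · intro h
    obtain ⟨g, hg⟩ := exists_mul_eq_one h
    -- In a domain a right inverse is two-sided.
    exact IsUnit.of_mul_eq_one g hg

instance : IsLocalRing (QPowerSeries q) where
  isUnit_or_isUnit_of_add_one {a b} h := by
    rw [isUnit_iff, isUnit_iff]
    by_contra! h'
    have : coeff 0 (a + b) = 1 := by rw [h, coeff_one, if_pos rfl]
    rw [coeff_add, h'.1, h'.2] at this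
    simp at this

/-! ### The adic topology -/

/-- A series all of whose terms have degree at least `m + 1` is a combination
of the indeterminates whose coefficients have only terms of degree at least `m`. -/
theorem exists_eq_sum_X_mul {f : QPowerSeries q} {m : ℕ}
    (hf : ∀ s : Fin n →₀ ℕ, s.degree < m + 1 → coeff s f = 0) :
    ∃ g : Fin n → QPowerSeries q, f = ∑ i, X q i * g i ∧
      ∀ i s, s.degree < m → coeff s (g i) = 0 := by
  classical
  -- Each monomial is assigned to the first variable occurring in it, so that no term is counted
  -- twice.
  refine ⟨fun i => mk fun u => if ∀ j < i, u j = 0 then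
    ((qCocycle q (Finsupp.single i 1) u)⁻¹ : kˣ) * coeff (u + Finsupp.single i 1) f else 0,
    ?_, ?_⟩
  · ext u
    rw [coeff_sum]
    simp only [X, coeff_monomial_mul]
    by_cases hu : u = 0
    · subst hu
      rw [hf 0 (by simp)]
      symm
      apply Finset.sum_eq_zero
      intro i _
      rw [if_neg]
      intro h
      have := h i
      simp at this
    · have hne : (Finset.univ.filter fun i => u i ≠ 0).Nonempty := by
        by_contra! h
        apply hu
        ext i
        by_contra hi
        have : i ∈ (Finset.univ.filter fun i => u i ≠ 0) :=
          Finset.mem_filter.2 ⟨Finset.mem_univ _, hi⟩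
        simp [h] at this
      set i := (Finset.univ.filter fun i => u i ≠ 0).min' hne with hi
      have hi1 : u i ≠ 0 := by simpa using Finset.min'_mem _ hne
      have hi2 : ∀ j < i, u j = 0 := by
        intro j hj
        by_contra h
        exact (Finset.min'_le (Finset.univ.filter fun i => u i ≠ 0) j (by simp [h])).not_gt hj
      have hle : Finsupp.single i 1 ≤ u := by
        rw [Finsupp.single_le_iff]; omega
      rw [Finset.sum_eq_single i]
      · rw [if_pos hle, one_mul]
        rw [coeff_mk, if_pos]
        · rw [tsub_add_cancel_of_le hle]
          simp
        · intro j hj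
          simp [hi2 j hj]
      · intro j _ hji
        rw [ite_eq_right_iff]
        intro h
        rw [Finsupp.single_le_iff] at h
        have hlt : i < j := by
          refine lt_of_le_of_ne ?_ (Ne.symm hji)
          by_contra! h'
          have := hi2 j h'
          omega
        rw [coeff_mk, if_neg]
        · simp
        · intro h'
          have := h' i hlt
          simp [hji] at this
          exact hi1 this
      · simp
  · intro i s hs
    rw [coeff_mk]
    split_ifs
    · have := hf (s + Finsupp.single i 1) (by simpa [map_add] using hs)
      rw [this, mul_zero]
    · rfl

theorem mem_augIdeal {f : QPowerSeries q} : f ∈ augIdeal q ↔ coeff 0 f = 0 := by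
  constructor
  · intro h
    let K : TwoSidedIdeal (QPowerSeries q) := TwoSidedIdeal.mk' {f | coeff 0 f = 0} rfl
      (fun {x y} hx hy => by
        simp only [Set.mem_ofPred_eq] at *; rw [coeff_add, hx, hy, add_zero])
      (fun {x} hx => by
        simp only [Set.mem_ofPred_eq] at *; rw [coeff_neg, hx, neg_zero])
      (fun {x y} hy => by
        simp only [Set.mem_ofPred_eq] at *; rw [coeff_zero_mul, hy, mul_zero])
      (fun {x y} hx => by
        simp only [Set.mem_ofPred_eq] at *; rw [coeff_zero_mul, hx, zero_mul])
    have hK : ∀ f, f ∈ K ↔ coeff 0 f = 0 := fun f => TwoSidedIdeal.mem_mk' ..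
    have : augIdeal q ≤ K := by
      refine TwoSidedIdeal.span_le.2 ?_
      rintro _ ⟨i, rfl⟩
      rw [SetLike.mem_coe, hK, X, coeff_monomial]
      rw [if_neg]
      intro h
      simpa using h.symm
    exact (hK f).1 (this h)
  · intro h
    obtain ⟨g, rfl, -⟩ := exists_eq_sum_X_mul (f := f) (m := 0) fun s hs => by
      rw [Nat.lt_one_iff, Finsupp.degree_eq_zero_iff] at hs
      rw [hs, h]
    refine sum_mem fun i _ => ?_
    exact TwoSidedIdeal.mul_mem_right _ _ _ (TwoSidedIdeal.subset_span ⟨i, rfl⟩)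

theorem mem_augIdeal_iff_not_isUnit {f : QPowerSeries q} : f ∈ augIdeal q ↔ ¬ IsUnit f := by
  rw [mem_augIdeal, isUnit_iff, not_not]

theorem coeff_mul_eq_zero {f g : QPowerSeries q} {a b : ℕ}
    (hf : ∀ s : Fin n →₀ ℕ, s.degree < a → coeff s f = 0)
    (hg : ∀ s : Fin n →₀ ℕ, s.degree < b → coeff s g = 0) :
    ∀ s : Fin n →₀ ℕ, s.degree < a + b → coeff s (f * g) = 0 := by
  intro s hs
  rw [coeff_mul]
  refine Finset.sum_eq_zero fun p hp => ?_
  rw [Finset.HasAntidiagonal.mem_antidiagonal] at hp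
  rw [← hp, map_add] at hs
  rcases lt_or_ge p.1.degree a with h | h
  · rw [hf _ h]; simp
  · rw [hg p.2 (by omega)]; simp

/-- The `J`-adic filtration is the filtration by order, so convergence can be read off
coefficientwise. -/
theorem mem_augIdeal_pow {f : QPowerSeries q} {m : ℕ} :
    f ∈ (augIdeal q).asIdeal ^ m ↔ ∀ s : Fin n →₀ ℕ, s.degree < m → coeff s f = 0 := by
  have hle : ∀ (m : ℕ) (f : QPowerSeries q), f ∈ (augIdeal q).asIdeal ^ m →
      ∀ s : Fin n →₀ ℕ, s.degree < m → coeff s f = 0 := by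
    intro m
    induction m with
    | zero => simp
    | succ m ih =>
      intro f h
      rw [Submodule.pow_succ] at h
      induction h using Submodule.mul_induction_on' with
      | mem_mul_mem x hx y hy =>
        rw [TwoSidedIdeal.mem_asIdeal, mem_augIdeal] at hy
        refine coeff_mul_eq_zero (ih x hx) (fun s hs => ?_)
        rw [Nat.lt_one_iff, Finsupp.degree_eq_zero_iff] at hs
        rw [hs, hy]
      | add x _ y _ hx hy =>
        intro s hs
        rw [coeff_add, hx s hs, hy s hs, add_zero]
  refine ⟨hle m f, ?_⟩
  induction m generalizing f with
  | zero =>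
    intro _
    rw [Submodule.pow_zero, ← mul_one f]
    exact Ideal.mul_mem_left _ _ (Submodule.one_le.1 le_rfl)
  | succ m ih =>
    intro h
    rcases m.eq_zero_or_pos with rfl | hm
    · rw [Submodule.pow_one, TwoSidedIdeal.mem_asIdeal, mem_augIdeal]
      exact h 0 (by simp)
    · rw [Submodule.pow_succ' _ hm.ne']
      obtain ⟨g, rfl, hg⟩ := exists_eq_sum_X_mul h
      refine sum_mem fun i _ => Ideal.mul_mem_mul ?_ (ih (hg i))
      exact TwoSidedIdeal.mem_asIdeal.2 (TwoSidedIdeal.subset_span ⟨i, rfl⟩)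

theorem isSeparatedComplete_augIdeal : IsSeparatedComplete (augIdeal q) := by
  refine ⟨fun x hx => ?_, fun f hf => ?_⟩
  · ext s
    exact mem_augIdeal_pow.1 (hx (s.degree + 1)) s (Nat.lt_succ_self _)
  · choose N hN using hf
    -- The coefficient at `s` is constant from the index `N (s.degree + 1)` on.
    refine ⟨mk fun s => coeff s (f (N (s.degree + 1))), fun m => ⟨N m, fun a ha => ?_⟩⟩
    rw [mem_augIdeal_pow]
    intro s hs
    set M := max a (N (s.degree + 1))
    have h1 := mem_augIdeal_pow.1 (hN m a ha M (ha.trans (le_max_left _ _))) s hs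
    have h2 := mem_augIdeal_pow.1 (hN (s.degree + 1) M (le_max_right _ _) _ le_rfl) s
      (Nat.lt_succ_self _)
    rw [coeff_sub, sub_eq_zero] at h1 h2 ⊢
    rw [h1, h2, coeff_mk]

end QPowerSeries

end

/-! ### Formal power series rings over an infinite field are factorial -/

section PolynomialPrime

open Polynomial

/-- A monic divisor of a polynomial distinguished at the maximal ideal is distinguished. -/
theorem Polynomial.IsDistinguishedAt.of_dvd {A : Type*} [CommRing A] [IsLocalRing A]
    {f p : A[X]} (hf : f.IsDistinguishedAt (IsLocalRing.maximalIdeal A)) (hp : p.Monic)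
    (h : p ∣ f) : p.IsDistinguishedAt (IsLocalRing.maximalIdeal A) := by
  refine ⟨⟨fun {i} hi => ?_⟩, hp⟩
  -- Modulo the maximal ideal `f` becomes a power of `X`, hence so does its monic divisor `p`.
  have h1 := Polynomial.map_dvd (Ideal.Quotient.mk (IsLocalRing.maximalIdeal A)) h
  rw [hf.map_eq_X_pow] at h1
  obtain ⟨j, -, hj⟩ := (dvd_prime_pow Polynomial.prime_X _).1 h1
  have h2 := Polynomial.eq_of_monic_of_associated (hp.map _) (Polynomial.monic_X_pow j) hj
  have h3 : p.natDegree = j := by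
    rw [← hp.natDegree_map (Ideal.Quotient.mk (IsLocalRing.maximalIdeal A)), h2,
      Polynomial.natDegree_X_pow]
  have h4 := congrArg (fun r => r.coeff i) h2
  simp only [Polynomial.coeff_map, Polynomial.coeff_X_pow] at h4
  rw [if_neg (by omega)] at h4
  exact Ideal.Quotient.eq_zero_iff_mem.1 h4

/-- Over a complete local factorial domain, a prime ideal of `A⟦X⟧` containing a series which is
nonzero modulo the maximal ideal of `A` contains a prime element. -/
theorem PowerSeries.exists_prime_mem_of_map_residue_ne_zero {A : Type*} [CommRing A] [IsDomain A]
    [IsLocalRing A] [IsAdicComplete (IsLocalRing.maximalIdeal A) A]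
    [UniqueFactorizationMonoid A] {g : PowerSeries A}
    (hg : g.map (IsLocalRing.residue A) ≠ 0) {I : Ideal (PowerSeries A)} (hI : I.IsPrime)
    (hgI : g ∈ I) : ∃ p ∈ I, Prime p := by
  -- Weierstrass preparation: up to a unit, `g` is a distinguished polynomial `f`, which can be
  -- factored in the factorial ring `A[X]`.
  obtain ⟨f, h, H⟩ := PowerSeries.exists_isWeierstrassFactorization hg
  have hfI : (f : PowerSeries A) ∈ I := by
    rw [H.eq_mul] at hgI
    exact (hI.mem_or_mem hgI).resolve_right fun hh =>
      hI.ne_top (Ideal.eq_top_of_isUnit_mem _ hh H.isUnit)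
  let I' : Ideal A[X] := I.comap (Polynomial.coeToPowerSeries.ringHom (R := A))
  have hI' : I'.IsPrime := Ideal.comap_isPrime _ _
  have hf0 : f ≠ 0 := H.isDistinguishedAt.monic.ne_zero
  obtain ⟨p, hpI, hpf, hp⟩ : ∃ p ∈ I', p ∣ f ∧ Prime p := by
    have hprod : (UniqueFactorizationMonoid.factors f).prod ∈ I' := by
      obtain ⟨u, hu⟩ := UniqueFactorizationMonoid.factors_prod hf0
      have : f * ((u⁻¹ : A[X]ˣ) : A[X]) = (UniqueFactorizationMonoid.factors f).prod := by
        rw [Units.mul_inv_eq_iff_eq_mul, hu]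
      rw [← this]
      exact I'.mul_mem_right _ hfI
    obtain ⟨p, hp, hpI⟩ := (hI'.multiset_prod_mem_iff_exists_mem _).1 hprod
    exact ⟨p, hpI, UniqueFactorizationMonoid.dvd_of_mem_factors hp,
      UniqueFactorizationMonoid.prime_of_factor p hp⟩
  -- The leading coefficient divides that of the monic `f`, so `p` can be normalized to a monic,
  -- hence distinguished, polynomial.
  have hlead : IsUnit p.leadingCoeff := by
    obtain ⟨c, rfl⟩ := hpf
    have := H.isDistinguishedAt.monic.leadingCoeff
    rw [Polynomial.leadingCoeff_mul] at this
    exact IsUnit.of_mul_eq_one _ this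
  obtain ⟨u, hu⟩ := hlead
  set p' : A[X] := p * Polynomial.C ((u⁻¹ : Aˣ) : A) with hp'
  have hunit : IsUnit (Polynomial.C ((u⁻¹ : Aˣ) : A)) := Polynomial.isUnit_C.2 (Units.isUnit _)
  have hass : Associated p p' := (associated_mul_unit_right p _ hunit)
  have hmonic : p'.Monic := by
    rw [Polynomial.Monic, hp', Polynomial.leadingCoeff_mul, Polynomial.leadingCoeff_C, ← hu,
      Units.mul_inv]
  have hdist := H.isDistinguishedAt.of_dvd hmonic (hass.symm.dvd.trans hpf)
  have hprime : Prime p' := (hass.prime_iff).1 hp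
  refine ⟨(p' : PowerSeries A), I'.mul_mem_right _ hpI, ?_⟩
  have hne : (p' : PowerSeries A) ≠ 0 := fun h0 => hmonic.ne_zero (by exact_mod_cast h0)
  rw [← Ideal.span_singleton_prime hne, ← Ideal.Quotient.isDomain_iff_prime]
  -- Weierstrass division identifies `A[X]/(p')` with `A⟦X⟧/(p')`, so `p'` stays prime in `A⟦X⟧`.
  have : IsDomain (A[X] ⧸ Ideal.span {p'}) :=
    (Ideal.Quotient.isDomain_iff_prime _).2
      ((Ideal.span_singleton_prime hmonic.ne_zero).2 hprime)
  exact hdist.algEquivQuotient.symm.toMulEquiv.isDomain _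

end PolynomialPrime

namespace MvPowerSeries

variable {k : Type*} [Field k] {n : ℕ}

/-- The power series with given coefficients. -/
noncomputable def ofCoeff {σ R : Type*} (c : (σ →₀ ℕ) → R) : MvPowerSeries σ R := c

theorem coeff_ofCoeff {σ R : Type*} [Semiring R] (c : (σ →₀ ℕ) → R) (s : σ →₀ ℕ) :
    coeff s (ofCoeff c) = c s := rfl

/-- This is the case of `QPowerSeries` in which all `q i j` are `1` and the cocycle is trivial. -/
theorem exists_eq_sum_X_mul {f : MvPowerSeries (Fin n) k} {m : ℕ}
    (hf : ∀ s : Fin n →₀ ℕ, s.degree < m + 1 → coeff s f = 0) :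
    ∃ g : Fin n → MvPowerSeries (Fin n) k, f = ∑ i, X i * g i ∧
      ∀ i s, s.degree < m → coeff s (g i) = 0 := by
  classical
  obtain ⟨g, hfg, hg⟩ := QPowerSeries.exists_eq_sum_X_mul (q := fun _ _ => (1 : kˣ))
    (f := QPowerSeries.mk fun s => coeff s f) (m := m) hf
  refine ⟨fun i => ofCoeff fun s => QPowerSeries.coeff s (g i), ?_, hg⟩
  ext u
  have h := congrArg (QPowerSeries.coeff u) hfg
  rw [QPowerSeries.coeff_mk, QPowerSeries.coeff_sum] at h
  rw [h, map_sum]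
  refine Finset.sum_congr rfl fun i _ => ?_
  rw [QPowerSeries.coeff_mul, coeff_mul]
  refine Finset.sum_congr (by congr!) fun p _ => ?_
  simp only [qCocycle, one_pow, Finset.prod_const_one, Units.val_one, one_mul, QPowerSeries.X,
    QPowerSeries.coeff_monomial, coeff_X, coeff_ofCoeff]

theorem mem_maximalIdeal_iff {f : MvPowerSeries (Fin n) k} :
    f ∈ IsLocalRing.maximalIdeal (MvPowerSeries (Fin n) k) ↔ constantCoeff f = 0 := by
  rw [IsLocalRing.mem_maximalIdeal, mem_nonunits_iff, isUnit_iff_constantCoeff,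
    isUnit_iff_ne_zero, not_not]

theorem mem_maximalIdeal_pow {f : MvPowerSeries (Fin n) k} {m : ℕ} :
    f ∈ IsLocalRing.maximalIdeal (MvPowerSeries (Fin n) k) ^ m ↔
      ∀ s : Fin n →₀ ℕ, s.degree < m → coeff s f = 0 := by
  classical
  induction m generalizing f with
  | zero => simp
  | succ m ih =>
    rw [pow_succ']
    constructor
    · intro h
      induction h using Submodule.mul_induction_on' with
      | mem_mul_mem x hx y hy =>
        rw [mem_maximalIdeal_iff] at hx
        rw [ih] at hy
        intro s hs
        rw [coeff_mul]
        refine Finset.sum_eq_zero fun p hp => ?_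
        rw [Finset.HasAntidiagonal.mem_antidiagonal] at hp
        by_cases h0 : p.1 = 0
        · rw [h0, coeff_zero_eq_constantCoeff_apply, hx, zero_mul]
        · rw [hy p.2, mul_zero]
          rw [← hp, map_add] at hs
          have : p.1.degree ≠ 0 := fun h => h0 ((Finsupp.degree_eq_zero_iff _).1 h)
          omega
      | add x _ y _ hx hy =>
        intro s hs
        rw [map_add, hx s hs, hy s hs, add_zero]
    · intro h
      obtain ⟨g, rfl, hg⟩ := exists_eq_sum_X_mul h
      refine sum_mem fun i _ => Ideal.mul_mem_mul ?_ (ih.2 (hg i))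
      rw [mem_maximalIdeal_iff, constantCoeff_X]

instance isAdicComplete_maximalIdeal :
    IsAdicComplete (IsLocalRing.maximalIdeal (MvPowerSeries (Fin n) k))
      (MvPowerSeries (Fin n) k) where
  haus' x hx := by
    ext s
    have := hx (s.degree + 1)
    rw [SModEq.zero, smul_eq_mul, Ideal.mul_top, mem_maximalIdeal_pow] at this
    exact this s (Nat.lt_succ_self _)
  prec' f hf := by
    refine ⟨ofCoeff fun s => coeff s (f (s.degree + 1)), fun m => ?_⟩
    rw [SModEq.sub_mem, smul_eq_mul, Ideal.mul_top, mem_maximalIdeal_pow]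
    intro s hs
    have := hf (Nat.succ_le_of_lt hs)
    rw [SModEq.sub_mem, smul_eq_mul, Ideal.mul_top, mem_maximalIdeal_pow] at this
    have := this s (Nat.lt_succ_self _)
    rw [map_sub, sub_eq_zero] at this ⊢
    rw [coeff_ofCoeff]
    exact this.symm

/-- The linear substitution `x₀ ↦ c₀ x₀`, `xᵢ ↦ xᵢ + cᵢ x₀`. -/
noncomputable def shear (c : Fin (n + 1) → k) (i : Fin (n + 1)) : MvPowerSeries (Fin (n + 1)) k :=
  if i = 0 then c 0 • X 0 else X i + c i • X 0

theorem hasSubst_shear (c : Fin (n + 1) → k) : HasSubst (shear c) := by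
  refine hasSubst_of_constantCoeff_zero fun i => ?_
  rw [shear]
  split_ifs <;> simp

theorem subst_shear_subst_shear {c b : Fin (n + 1) → k} (h0 : b 0 * c 0 = 1)
    (h : ∀ i, i ≠ 0 → c i + b i * c 0 = 0) (f : MvPowerSeries (Fin (n + 1)) k) :
    subst (shear c) (subst (shear b) f) = f := by
  rw [subst_comp_subst_apply (hasSubst_shear b) (hasSubst_shear c)]
  have : (fun s => subst (shear c) (shear b s)) = (X : Fin (n + 1) → MvPowerSeries _ k) := by
    funext i
    have hX : ∀ j, subst (shear c) (X j : MvPowerSeries (Fin (n + 1)) k) = shear c j :=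
      subst_X (hasSubst_shear c)
    by_cases hi : i = 0
    · rw [hi, shear, if_pos rfl, subst_smul (hasSubst_shear c), hX, shear, if_pos rfl, smul_smul,
        h0, one_smul]
    · rw [shear, if_neg hi, subst_add (hasSubst_shear c), subst_smul (hasSubst_shear c), hX, hX,
        shear, if_neg hi, shear, if_pos rfl, smul_smul, add_assoc, ← add_smul, h i hi, zero_smul,
        add_zero]
  rw [this, subst_self, id]

/-- The automorphism given by a linear substitution `x₀ ↦ c₀ x₀`, `xᵢ ↦ xᵢ + cᵢ x₀`. -/
noncomputable def shearEquiv (c : Fin (n + 1) → k) (h0 : c 0 ≠ 0) :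
    MvPowerSeries (Fin (n + 1)) k ≃+* MvPowerSeries (Fin (n + 1)) k where
  toFun := subst (shear c)
  invFun := subst (shear fun i => if i = 0 then (c 0)⁻¹ else - (c i * (c 0)⁻¹))
  left_inv f := subst_shear_subst_shear (by simp [h0])
    (fun i hi => by simp [hi]) f
  right_inv f := subst_shear_subst_shear (by simp [h0])
    (fun i hi => by simp [hi, h0]) f
  map_mul' := subst_mul (hasSubst_shear c)
  map_add' := subst_add (hasSubst_shear c)

/-- Restriction of a power series to the axis of the variable `x₀`. -/
noncomputable def restrictAxis (k : Type*) [Field k] (n : ℕ) :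
    MvPowerSeries (Fin (n + 1)) k →+* PowerSeries k :=
  (PowerSeries.map constantCoeff).comp
    (finSuccEquiv k n : MvPowerSeries (Fin (n + 1)) k →+* PowerSeries (MvPowerSeries (Fin n) k))

theorem coeff_restrictAxis (f : MvPowerSeries (Fin (n + 1)) k) (d : ℕ) :
    PowerSeries.coeff d (restrictAxis k n f) = coeff (Finsupp.cons d 0) f := by
  rw [← coeff_coeff_finSuccEquiv]
  rfl

theorem restrictAxis_shear (c : Fin (n + 1) → k) (i : Fin (n + 1)) :
    restrictAxis k n (shear c i) = PowerSeries.C (c i) * PowerSeries.X := by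
  rw [shear]
  split_ifs with hi
  · rw [hi, smul_eq_C_mul, map_mul]
    simp [restrictAxis]
  · obtain ⟨j, rfl⟩ := Fin.exists_succ_eq.2 hi
    rw [smul_eq_C_mul, map_add, map_mul]
    simp [restrictAxis]

/-- On the axis of `x₀` the sheared series is `f(c₀T, …, cₙT)`, whose coefficient of `T^d` is the
value at `c` of the homogeneous part of `f` of degree `d`. -/
theorem coeff_cons_zero_subst_shear (c : Fin (n + 1) → k) (f : MvPowerSeries (Fin (n + 1)) k)
    (d : ℕ) : coeff (Finsupp.cons d 0) (subst (shear c) f) =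
      ∑ᶠ s : Fin (n + 1) →₀ ℕ, coeff s f * if s.degree = d then ∏ i, c i ^ s i else 0 := by
  rw [coeff_subst (hasSubst_shear c)]
  refine finsum_congr fun s => ?_
  rw [← coeff_restrictAxis, Finsupp.prod_fintype _ _ (by simp), map_prod, smul_eq_mul]
  congr 1
  simp only [map_pow, restrictAxis_shear, mul_pow, Finset.prod_mul_distrib,
    Finset.prod_pow_eq_pow_sum]
  have : ∏ i, (PowerSeries.C (c i) : PowerSeries k) ^ s i = PowerSeries.C (∏ i, c i ^ s i) := by
    simp [map_prod]
  rw [this, PowerSeries.coeff_C_mul, PowerSeries.coeff_X_pow, Finsupp.degree_eq_sum]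
  simp [eq_comm]

/-- A nonzero power series is nonzero on the axis of `x₀` after a suitable linear substitution. -/
theorem exists_restrictAxis_shearEquiv_ne_zero [Infinite k] {f : MvPowerSeries (Fin (n + 1)) k}
    (hf : f ≠ 0) :
    ∃ (c : Fin (n + 1) → k) (h0 : c 0 ≠ 0), restrictAxis k n (shearEquiv c h0 f) ≠ 0 := by
  classical
  obtain ⟨s₀, hs₀⟩ : ∃ s, coeff s f ≠ 0 := by
    by_contra! h
    exact hf (ext h)
  have hfin : {s : Fin (n + 1) →₀ ℕ | s.degree = s₀.degree}.Finite :=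
    (Finsupp.finite_of_degree_le s₀.degree).subset fun s (hs : s.degree = _) => hs.le
  -- `F` is a nonzero homogeneous part of `f`.
  let F : MvPolynomial (Fin (n + 1)) k :=
    ∑ s ∈ hfin.toFinset, MvPolynomial.monomial s (coeff s f)
  have hF : F ≠ 0 := by
    intro h
    have := congrArg (MvPolynomial.coeff s₀) h
    simp only [F, MvPolynomial.coeff_sum, MvPolynomial.coeff_monomial, MvPolynomial.coeff_zero,
      Finset.sum_ite_eq'] at this
    rw [if_pos (by simp)] at this
    exact hs₀ this
  -- The factor `X 0` ensures `c 0 ≠ 0`, which makes the shear invertible.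
  obtain ⟨c, hc⟩ : ∃ c : Fin (n + 1) → k, MvPolynomial.eval c (F * MvPolynomial.X 0) ≠ 0 := by
    by_contra! h
    refine mul_ne_zero hF (MvPolynomial.X_ne_zero 0) (MvPolynomial.funext fun c => ?_)
    rw [h c, map_zero]
  rw [map_mul, MvPolynomial.eval_X] at hc
  refine ⟨c, right_ne_zero_of_mul hc, fun h => left_ne_zero_of_mul hc ?_⟩
  have h1 := congrArg (PowerSeries.coeff s₀.degree) h
  rw [coeff_restrictAxis, map_zero] at h1
  rw [← h1]
  refine Eq.trans ?_ (coeff_cons_zero_subst_shear c f _).symm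
  rw [finsum_eq_sum_of_support_subset (s := hfin.toFinset)]
  · simp only [F, map_sum, MvPolynomial.eval_monomial]
    refine Finset.sum_congr rfl fun s hs => ?_
    rw [if_pos (by simpa using hs), Finsupp.prod_fintype _ _ (by simp)]
  · intro s hs
    by_contra h'
    apply hs
    simp only [Set.Finite.coe_toFinset, Set.mem_ofPred_eq] at h'
    simp [h']

instance isDomain_of_field : IsDomain (MvPowerSeries (Fin n) k) :=
  NoZeroDivisors.to_isDomain _

/-- Kaplansky's criterion asks for a prime element in every nonzero prime ideal. A shear makes some
element of the ideal regular in `x₀`, and Weierstrass preparation over the ring in the other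
variables finds the prime. -/
instance uniqueFactorizationMonoid_fin [Infinite k] :
    UniqueFactorizationMonoid (MvPowerSeries (Fin n) k) := by
  induction n with
  | zero =>
    exact (isEmptyEquiv (Fin 0) k).symm.toMulEquiv.uniqueFactorizationMonoid inferInstance
  | succ n ih =>
    refine UniqueFactorizationMonoid.iff_exists_prime_mem_of_isPrime.2 fun P hP hP' => ?_
    obtain ⟨f, hfP, hf⟩ := (Submodule.ne_bot_iff P).1 hP
    obtain ⟨c, h0, hc⟩ := exists_restrictAxis_shearEquiv_ne_zero hf
    let e : MvPowerSeries (Fin (n + 1)) k ≃+* PowerSeries (MvPowerSeries (Fin n) k) :=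
      (shearEquiv c h0).trans (finSuccEquiv k n).toRingEquiv
    have hres : (e f).map (IsLocalRing.residue _) ≠ 0 := by
      intro h
      apply hc
      ext d
      have h1 := congrArg (PowerSeries.coeff d) h
      rw [PowerSeries.coeff_map, map_zero, IsLocalRing.residue_eq_zero_iff,
        mem_maximalIdeal_iff] at h1
      rw [map_zero]
      exact h1
    obtain ⟨p, hp, hp'⟩ := PowerSeries.exists_prime_mem_of_map_residue_ne_zero hres
      (I := P.comap (e.symm : PowerSeries (MvPowerSeries (Fin n) k) →+* _))
      (Ideal.comap_isPrime _ _) (by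
        rw [Ideal.mem_comap]
        simpa using hfP)
    exact ⟨e.symm p, hp, (MulEquiv.prime_iff e.symm.toMulEquiv).2 hp'⟩

end MvPowerSeries

/-! ### The central power series ring and freeness over it -/

noncomputable section

/-- `d` lists the exponents for which the centre of `k_q[[x₁,…,xₙ]]` is `k[[x₁^(d₁),…,xₙ^(dₙ)]]`. -/
structure IsCentralExponent {k : Type*} [Field k] {n : ℕ} (q : Fin n → Fin n → kˣ)
    (d : Fin n → ℕ) : Prop where
  pos : ∀ i, 0 < d i
  pow_left : ∀ i j, q i j ^ d i = 1
  pow_right : ∀ i j, q i j ^ d j = 1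
  dvd : ∀ s : Fin n →₀ ℕ, (∀ i, ∏ j, q i j ^ s j = 1) → ∀ i, d i ∣ s i

/-- The exponent `(d₁ v₁, …, dₙ vₙ)`. -/
def dilate {n : ℕ} (d : Fin n → ℕ) (v : Fin n →₀ ℕ) : Fin n →₀ ℕ :=
  Finsupp.equivFunOnFinite.symm fun i => d i * v i

theorem dilate_apply {n : ℕ} (d : Fin n → ℕ) (v : Fin n →₀ ℕ) (i : Fin n) :
    dilate d v i = d i * v i := rfl

theorem dilate_add {n : ℕ} (d : Fin n → ℕ) (v w : Fin n →₀ ℕ) :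
    dilate d (v + w) = dilate d v + dilate d w := by
  ext i
  simp [dilate_apply, mul_add]

theorem dilate_zero {n : ℕ} (d : Fin n → ℕ) : dilate d 0 = 0 := by
  ext i
  simp [dilate_apply]

theorem dilate_injective {n : ℕ} {d : Fin n → ℕ} (hd : ∀ i, 0 < d i) :
    Function.Injective (dilate d) := by
  intro v w h
  ext i
  have := DFunLike.congr_fun h i
  simp only [dilate_apply] at this
  exact Nat.eq_of_mul_eq_mul_left (hd i) this

/-- The exponent `(r₁, …, rₙ)` of a tuple of residues. -/
def residueExponent {n : ℕ} {d : Fin n → ℕ} (r : ∀ i, Fin (d i)) : Fin n →₀ ℕ :=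
  Finsupp.equivFunOnFinite.symm fun i => (r i : ℕ)

theorem residueExponent_apply {n : ℕ} {d : Fin n → ℕ} (r : ∀ i, Fin (d i)) (i : Fin n) :
    residueExponent r i = r i := rfl

theorem exists_eq_residueExponent_add_dilate {n : ℕ} {d : Fin n → ℕ} (hd : ∀ i, 0 < d i)
    (u : Fin n →₀ ℕ) : ∃ (r : ∀ i, Fin (d i)) (v : Fin n →₀ ℕ),
      u = residueExponent r + dilate d v := by
  refine ⟨fun i => ⟨u i % d i, Nat.mod_lt _ (hd i)⟩,
    Finsupp.equivFunOnFinite.symm fun i => u i / d i, ?_⟩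
  ext i
  simp [dilate_apply, residueExponent_apply, Nat.mod_add_div]

theorem exists_eq_dilate {n : ℕ} {d : Fin n → ℕ} {u : Fin n →₀ ℕ} (h : ∀ i, d i ∣ u i) :
    ∃ v, u = dilate d v := by
  choose c hc using h
  refine ⟨Finsupp.equivFunOnFinite.symm c, ?_⟩
  ext i
  simp [dilate_apply, hc]

namespace QPowerSeries

variable {k : Type*} [Field k] {n : ℕ} {q : Fin n → Fin n → kˣ} {d : Fin n → ℕ}

theorem qCocycle_dilate_left (h : IsCentralExponent q d) (v t : Fin n →₀ ℕ) :
    qCocycle q (dilate d v) t = 1 := by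
  simp [qCocycle, dilate_apply, mul_assoc, pow_mul, h.pow_left]

theorem qCocycle_dilate_right (h : IsCentralExponent q d) (s v : Fin n →₀ ℕ) :
    qCocycle q s (dilate d v) = 1 := by
  simp [qCocycle, dilate_apply, mul_left_comm, pow_mul, h.pow_right]

variable (q d) in
/-- The series obtained from `g` by the substitution `xᵢ ↦ xᵢ^(dᵢ)`. -/
def ofCenter (g : MvPowerSeries (Fin n) k) : QPowerSeries q := mk fun u =>
  if ∀ i, d i ∣ u i then
    MvPowerSeries.coeff (Finsupp.equivFunOnFinite.symm fun i => u i / d i) g else 0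

theorem coeff_ofCenter_dilate (hd : ∀ i, 0 < d i) (g : MvPowerSeries (Fin n) k)
    (v : Fin n →₀ ℕ) : coeff (dilate d v) (ofCenter q d g) = MvPowerSeries.coeff v g := by
  have h : ∀ i, d i ∣ dilate d v i := fun i => Dvd.intro _ rfl
  rw [ofCenter, coeff_mk, if_pos h]
  congr 2
  ext i
  simp [dilate_apply, hd i]

theorem coeff_ofCenter_of_not_dvd (g : MvPowerSeries (Fin n) k)
    {u : Fin n →₀ ℕ} (h : ¬ ∀ i, d i ∣ u i) : coeff u (ofCenter q d g) = 0 := by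
  rw [ofCenter, coeff_mk, if_neg h]

theorem mul_ofCenter_comm (h : IsCentralExponent q d) (f : QPowerSeries q)
    (g : MvPowerSeries (Fin n) k) : f * ofCenter q d g = ofCenter q d g * f := by
  ext u
  rw [coeff_mul, coeff_mul, ← Finset.sum_equiv (Equiv.prodComm _ _)
    (s := Finset.HasAntidiagonal.antidiagonal u)
    (f := fun p => (qCocycle q p.2 p.1 : k) * (coeff p.2 f * coeff p.1 (ofCenter q d g)))
    (by simp [add_comm]) (fun _ _ => rfl)]
  refine Finset.sum_congr rfl fun p _ => ?_
  by_cases hp : ∀ i, d i ∣ p.1 i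
  · obtain ⟨v, hv⟩ := exists_eq_dilate hp
    rw [hv, qCocycle_dilate_left h, qCocycle_dilate_right h, mul_comm (coeff _ f)]
  · simp [coeff_ofCenter_of_not_dvd g hp]

/-- The coefficient of `x^r` when `k_q[[x₁,…,xₙ]]` is viewed as a module over
`k[[x₁^(d₁),…,xₙ^(dₙ)]]`. -/
def component (f : QPowerSeries q) (r : ∀ i, Fin (d i)) : MvPowerSeries (Fin n) k :=
  MvPowerSeries.ofCoeff fun v => coeff (residueExponent r + dilate d v) f

theorem coeff_component (f : QPowerSeries q) (r : ∀ i, Fin (d i)) (v : Fin n →₀ ℕ) :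
    MvPowerSeries.coeff v (component f r) = coeff (residueExponent r + dilate d v) f := rfl

theorem component_injective (hd : ∀ i, 0 < d i) :
    Function.Injective (component (q := q) (d := d)) := by
  intro f g h
  ext u
  obtain ⟨r, v, rfl⟩ := exists_eq_residueExponent_add_dilate hd u
  rw [← coeff_component, ← coeff_component, h]

theorem component_surjective (hd : ∀ i, 0 < d i) :
    Function.Surjective (component (q := q) (d := d)) := by
  intro c
  refine ⟨mk fun u => MvPowerSeries.coeff
    (Finsupp.equivFunOnFinite.symm fun i => u i / d i)
    (c fun i => ⟨u i % d i, Nat.mod_lt _ (hd i)⟩), ?_⟩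
  funext r
  ext v
  refine (coeff_component _ _ _).trans ?_
  rw [coeff_mk]
  have h1 : (Finsupp.equivFunOnFinite.symm fun i => (residueExponent r + dilate d v) i / d i)
      = v := by
    ext i
    simp [residueExponent_apply, dilate_apply, Nat.add_mul_div_left _ _ (hd i),
      Nat.div_eq_of_lt (r i).2]
  have h2 : (fun i => (⟨(residueExponent r + dilate d v) i % d i,
      Nat.mod_lt _ (hd i)⟩ : Fin (d i))) = r := by
    funext i
    simp [residueExponent_apply, dilate_apply, Nat.mod_eq_of_lt (r i).2]
  rw [h1, h2]

/-- A central factor shifts exponents by multiples of the `dᵢ` without changing residues, and its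
cocycle is trivial. Components are therefore linear over the central subring. -/
theorem component_mul_ofCenter (h : IsCentralExponent q d) (f : QPowerSeries q)
    (g : MvPowerSeries (Fin n) k) (r : ∀ i, Fin (d i)) :
    component (f * ofCenter q d g) r = component f r * g := by
  classical
  ext v
  rw [coeff_component, coeff_mul, MvPowerSeries.coeff_mul]
  symm
  refine Finset.sum_of_injOn (fun p => (residueExponent r + dilate d p.1, dilate d p.2))
    ?_ ?_ ?_ ?_
  · rintro ⟨a, b⟩ _ ⟨a', b'⟩ _ hab
    simp only [Prod.mk.injEq, add_right_inj] at hab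
    rw [dilate_injective h.pos hab.1, dilate_injective h.pos hab.2]
  · rintro ⟨a, b⟩ hab
    simp only [Finset.mem_coe, Finset.HasAntidiagonal.mem_antidiagonal] at hab ⊢
    rw [← hab, dilate_add, add_assoc]
  · rintro ⟨a, b⟩ hab hne
    rw [Finset.HasAntidiagonal.mem_antidiagonal] at hab
    simp only at hab ⊢
    by_cases hb : ∀ i, d i ∣ b i
    · obtain ⟨w, rfl⟩ := exists_eq_dilate hb
      exfalso
      apply hne
      -- Because `rᵢ < dᵢ`, the inequality `dᵢ wᵢ ≤ rᵢ + dᵢ vᵢ` forces `wᵢ ≤ vᵢ`.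
      have hw : w ≤ v := by
        intro i
        have h1 := DFunLike.congr_fun hab i
        simp only [Finsupp.add_apply, dilate_apply, residueExponent_apply] at h1
        have h2 := (r i).2
        by_contra! h3
        have h4 : d i * (v i + 1) ≤ d i * w i := Nat.mul_le_mul_left _ h3
        rw [mul_add] at h4
        omega
      refine ⟨(v - w, w), ?_, ?_⟩
      · simp [tsub_add_cancel_of_le hw]
      · simp only [Prod.mk.injEq, and_true]
        apply add_right_cancel (b := dilate d w)
        rw [hab, add_assoc, ← dilate_add, tsub_add_cancel_of_le hw]
    · simp [coeff_ofCenter_of_not_dvd g hb]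
  · rintro ⟨a, b⟩ _
    simp only [qCocycle_dilate_right h, coeff_ofCenter_dilate h.pos, coeff_component,
      Units.val_one, one_mul]

theorem component_ofCenter (hd : ∀ i, 0 < d i) (g : MvPowerSeries (Fin n) k)
    (r : ∀ i, Fin (d i)) :
    component (ofCenter q d g) r = if residueExponent r = 0 then g else 0 := by
  ext v
  rw [coeff_component]
  split_ifs with hr
  · rw [hr, zero_add, coeff_ofCenter_dilate hd]
  · rw [coeff_ofCenter_of_not_dvd, map_zero]
    intro h'
    apply hr
    ext i
    have := (Nat.dvd_add_left (Dvd.intro _ rfl : d i ∣ dilate d v i)).1 (h' i)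
    rw [residueExponent_apply] at this ⊢
    exact Nat.eq_zero_of_dvd_of_lt this (r i).2

theorem ofCenter_monomial (hd : ∀ i, 0 < d i) (v : Fin n →₀ ℕ) (a : k) :
    ofCenter q d (MvPowerSeries.monomial v a) = monomial (dilate d v) a := by
  classical
  ext u
  rw [coeff_monomial]
  by_cases hu : ∀ i, d i ∣ u i
  · obtain ⟨w, rfl⟩ := exists_eq_dilate hu
    rw [coeff_ofCenter_dilate hd, MvPowerSeries.coeff_monomial]
    simp [(dilate_injective hd).eq_iff]
  · rw [coeff_ofCenter_of_not_dvd _ hu, if_neg]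
    rintro rfl
    exact hu fun i => Dvd.intro _ rfl

/-- The embedding of the centre `k[[x₁^(d₁),…,xₙ^(dₙ)]]` of `k_q[[x₁,…,xₙ]]`. -/
def centerHom (h : IsCentralExponent q d) : MvPowerSeries (Fin n) k →+* QPowerSeries q where
  toFun := ofCenter q d
  map_one' := ofCenter_monomial h.pos 0 1 |>.trans (by rw [dilate_zero]; rfl)
  map_mul' f g := by
    apply component_injective h.pos
    funext r
    rw [component_mul_ofCenter h, component_ofCenter h.pos, component_ofCenter h.pos]
    split_ifs <;> simp
  map_zero' := by
    ext u
    rw [ofCenter, coeff_mk, map_zero, ite_self, coeff_zero]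
  map_add' f g := by
    ext u
    rw [coeff_add]
    simp only [ofCenter, coeff_mk, map_add]
    split_ifs <;> simp

theorem centerHom_apply (h : IsCentralExponent q d) (g : MvPowerSeries (Fin n) k) :
    centerHom h g = ofCenter q d g := rfl

theorem centerHom_injective (h : IsCentralExponent q d) : Function.Injective (centerHom h) := by
  intro f g hfg
  ext v
  rw [← coeff_ofCenter_dilate (q := q) h.pos, ← coeff_ofCenter_dilate (q := q) h.pos,
    ← centerHom_apply h, hfg, centerHom_apply]

/-- `k_q[[x₁,…,xₙ]]` as an algebra over its centre. -/
abbrev centerAlgebra (h : IsCentralExponent q d) :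
    Algebra (MvPowerSeries (Fin n) k) (QPowerSeries q) :=
  (centerHom h).toAlgebra' fun g f => (mul_ofCenter_comm h f g).symm

/-- `k_q[[x₁,…,xₙ]]` is free over its centre on the monomials `x^r`, `0 ≤ rᵢ < dᵢ`. -/
def componentEquiv (h : IsCentralExponent q d) :
    letI := centerAlgebra h
    QPowerSeries q ≃ₗ[MvPowerSeries (Fin n) k] ((∀ i, Fin (d i)) → MvPowerSeries (Fin n) k) :=
  letI := centerAlgebra h
  LinearEquiv.ofBijective
    { toFun := component
      map_add' := fun _ _ => rfl
      map_smul' := fun g f => by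
        funext r
        rw [Algebra.smul_def, RingHom.id_apply, Pi.smul_apply, smul_eq_mul, mul_comm g,
          ← component_mul_ofCenter h, mul_ofCenter_comm h]
        rfl }
    ⟨component_injective h.pos, component_surjective h.pos⟩

theorem isNoetherianRing (h : IsCentralExponent q d) : IsNoetherianRing (QPowerSeries q) := by
  let _ := centerAlgebra h
  have : IsNoetherian (MvPowerSeries (Fin n) k) (QPowerSeries q) :=
    isNoetherian_of_linearEquiv (componentEquiv h).symm
  exact isNoetherian_of_tower (MvPowerSeries (Fin n) k) this

theorem isNoetherianRing_mulOpposite (h : IsCentralExponent q d) :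
    IsNoetherianRing (QPowerSeries q)ᵐᵒᵖ := by
  let _ := centerAlgebra h
  have : IsNoetherian (MvPowerSeries (Fin n) k) (QPowerSeries q)ᵐᵒᵖ :=
    isNoetherian_of_linearEquiv
      ((componentEquiv h).symm.trans (MulOpposite.opLinearEquiv (MvPowerSeries (Fin n) k)))
  exact isNoetherian_of_tower (MvPowerSeries (Fin n) k) this

end QPowerSeries

/-! ### Polynomial identities -/

/-- The standard polynomial of degree `m`. -/
def standardPolynomial (k : Type*) [Field k] (m : ℕ) : FreeAlgebra k ℕ :=
  ∑ σ : Equiv.Perm (Fin m), Equiv.Perm.sign σ •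
    (List.ofFn fun i => FreeAlgebra.ι k (σ i : ℕ)).prod

/-- In the monoid algebra of the free monoid, distinct permutations give distinct words, so the word
of the identity keeps coefficient `1`. -/
theorem standardPolynomial_ne_zero (k : Type*) [Field k] (m : ℕ) :
    standardPolynomial k m ≠ 0 := by
  classical
  intro h
  have h1 := congrArg (FreeAlgebra.lift k fun i : ℕ =>
    MonoidAlgebra.of k (FreeMonoid ℕ) (FreeMonoid.of i)) h
  have key : ∀ l : List ℕ, (l.map fun i =>
      MonoidAlgebra.of k (FreeMonoid ℕ) (FreeMonoid.of i)).prod =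
      MonoidAlgebra.of k (FreeMonoid ℕ) (FreeMonoid.ofList l) := by
    intro l
    rw [← FreeMonoid.lift_ofList (fun i => MonoidAlgebra.of k (FreeMonoid ℕ) (FreeMonoid.of i))]
    exact DFunLike.congr_fun (FreeMonoid.hom_eq fun _ => by simp) _
  have hkey : ∀ σ : Equiv.Perm (Fin m), FreeAlgebra.lift k (fun i : ℕ =>
      MonoidAlgebra.of k (FreeMonoid ℕ) (FreeMonoid.of i))
        (List.ofFn fun i => FreeAlgebra.ι k (σ i : ℕ)).prod =
      MonoidAlgebra.of k (FreeMonoid ℕ) (FreeMonoid.ofList (List.ofFn fun i => (σ i : ℕ))) := by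
    intro σ
    rw [← key, map_list_prod, List.map_ofFn, List.map_ofFn]
    simp [Function.comp_def]
  rw [standardPolynomial, map_sum, map_zero] at h1
  have h2 := congrArg (fun x => x.coeff (FreeMonoid.ofList (List.ofFn fun i : Fin m => (i : ℕ)))) h1
  simp only [Units.smul_def, map_zsmul, hkey] at h2
  simp [MonoidAlgebra.coeff_sum] at h2
  rw [Finset.sum_eq_single 1] at h2
  · simp at h2
  · intro σ _ hσ
    rw [Finsupp.single_apply, if_neg]
    intro h'
    apply hσ
    have h3 := List.ofFn_injective (FreeMonoid.ofList.injective h')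
    ext i
    exact congrFun h3 i
  · simp

/-- An algebra over a field `k` satisfies a polynomial identity if it is a finite free module over
a central domain. -/
theorem isPIAlgebra_of_finite {k Z A : Type*} [Field k] [CommRing Z] [IsDomain Z] [Ring A]
    [Algebra k A] [Algebra Z A] [Module.Finite Z A] [Module.IsTorsionFree Z A] :
    IsPIAlgebra k A := by
  refine ⟨standardPolynomial k (Module.finrank Z A + 1), standardPolynomial_ne_zero k _,
    fun a => ?_⟩
  -- The standard polynomial is the alternatization of the product, and more elements than the rank
  -- are linearly dependent over `Z`.
  have h := AlternatingMap.map_linearDependent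
    (MultilinearMap.alternatization
      (MultilinearMap.mkPiAlgebraFin Z (Module.finrank Z A + 1) A)) (fun i => a i) fun hli => by
        have := hli.fintype_card_le_finrank
        simp at this
  rw [MultilinearMap.alternatization_apply] at h
  rw [← h, standardPolynomial, map_sum]
  refine Finset.sum_congr rfl fun σ _ => ?_
  rw [Units.smul_def, Units.smul_def, map_zsmul, map_list_prod, List.map_ofFn]
  simp [Function.comp_def]

namespace QPowerSeries

theorem isPIAlgebra {k : Type*} [Field k] {n : ℕ} {q : Fin n → Fin n → kˣ} {d : Fin n → ℕ}
    (h : IsCentralExponent q d) : IsPIAlgebra k (QPowerSeries q) := by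
  let _ := centerAlgebra h
  have : Module.Finite (MvPowerSeries (Fin n) k) (QPowerSeries q) :=
    Module.Finite.equiv (componentEquiv h).symm
  have : Module.Free (MvPowerSeries (Fin n) k) (QPowerSeries q) :=
    Module.Free.of_equiv (componentEquiv h).symm
  exact isPIAlgebra_of_finite (Z := MvPowerSeries (Fin n) k)

end QPowerSeries

end

/-! ### Height-one primes and isotypic parts -/

noncomputable section

theorem le_dilate {n : ℕ} {d : Fin n → ℕ} (hd : ∀ i, 0 < d i) (v : Fin n →₀ ℕ) :
    v ≤ dilate d v := fun i => Nat.le_mul_of_pos_left _ (hd i)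

/-- In a ring whose zero ideal is prime, a nonzero prime ideal contained in a height-one prime
ideal is equal to it. -/
theorem IsHeightOnePrime.eq_of_le {R : Type*} [Ring R]
    (h0 : IsPrimeTwoSided (⊥ : TwoSidedIdeal R)) {P Q : TwoSidedIdeal R}
    (hP : IsHeightOnePrime P) (hQ : IsPrimeTwoSided Q) (hne : Q ≠ ⊥) (hle : Q ≤ P) : Q = P := by
  obtain ⟨hP', hP⟩ := hP
  by_contra hPQ
  have h1 : (⟨Q, hQ⟩ : {Q : TwoSidedIdeal R // IsPrimeTwoSided Q}) < ⟨P, hP'⟩ :=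
    lt_of_le_of_ne hle fun h => hPQ (congrArg Subtype.val h)
  have h2 : (⟨⊥, h0⟩ : {Q : TwoSidedIdeal R // IsPrimeTwoSided Q}) < ⟨Q, hQ⟩ :=
    lt_of_le_of_ne (bot_le (a := Q)) fun h => hne (congrArg Subtype.val h).symm
  -- A strict chain `⊥ < Q < P` would give `P` height at least two.
  have h3 := Order.height_mono h1.le
  rw [hP] at h3
  have h4 := Order.height_strictMono h1 (h3.trans_lt (by decide))
  rw [hP, Order.lt_one_iff, Order.height_eq_zero] at h4
  exact h2.not_ge (h4 h2.le)

theorem IsHeightOnePrime.ne_bot {R : Type*} [Ring R] {P : TwoSidedIdeal R}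
    (hP : IsHeightOnePrime P) : P ≠ ⊥ := by
  obtain ⟨hP', hP⟩ := hP
  rintro rfl
  have : IsMin (⟨⊥, hP'⟩ : {Q : TwoSidedIdeal R // IsPrimeTwoSided Q}) :=
    fun Q _ => (bot_le (a := Q.1))
  rw [Order.height_eq_zero.2 this] at hP
  exact zero_ne_one hP

theorem MvPowerSeries.not_prime_dvd_monomial {k : Type*} [Field k] {n : ℕ}
    {p : MvPowerSeries (Fin n) k} (hp : Prime p) (hX : ∀ i, ¬ p ∣ X i) (v : Fin n →₀ ℕ) {a : k}
    (ha : a ≠ 0) : ¬ p ∣ monomial v a := by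
  rw [monomial_eq', hp.dvd_mul]
  rintro (h | h)
  · refine hp.not_isUnit (isUnit_of_dvd_unit h ?_)
    exact (isUnit_iff_ne_zero.2 ha).map C
  · obtain ⟨i, -, hi⟩ := (hp.dvd_finsetProd_iff _).1 h
    exact hX i (hp.dvd_of_dvd_pow hi)

namespace QPowerSeries

variable {k : Type*} [Field k] {n : ℕ} {q : Fin n → Fin n → kˣ} {d : Fin n → ℕ}

/-- The two cocycles contribute the indices below and above `i` respectively; antisymmetry merges
them into one product. -/
theorem commutator_single (hq : IsMulAntisymm q) (i : Fin n) (t : Fin n →₀ ℕ) :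
    commutator q (Finsupp.single i 1) t = ∏ j, q i j ^ t j := by
  have h1 : qCocycle q (Finsupp.single i 1) t = ∏ j, if j < i then q i j ^ t j else 1 := by
    rw [qCocycle, Finset.prod_eq_single i, Finset.prod_filter]
    · simp
    · intro a _ ha
      simp [ha.symm]
    · simp
  have h2 : qCocycle q t (Finsupp.single i 1) = ∏ j, if i < j then q j i ^ t j else 1 := by
    rw [qCocycle]
    refine Finset.prod_congr rfl fun a _ => ?_
    rw [Finset.prod_filter, Finset.prod_eq_single i]
    · simp
    · intro b _ hb
      simp [hb.symm]
    · simp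
  rw [commutator, h1, h2, ← Finset.prod_div_distrib]
  refine Finset.prod_congr rfl fun j _ => ?_
  rcases lt_trichotomy j i with h | rfl | h
  · simp [h, h.not_gt]
  · simp [hq.1]
  · simp [h, h.not_gt, hq.2 i j]

theorem commutator_single_pow (h : IsCentralExponent q d) (hq : IsMulAntisymm q) (i : Fin n)
    (t : Fin n →₀ ℕ) : commutator q (Finsupp.single i 1) t ^ d i = 1 := by
  rw [commutator_single hq, ← Finset.prod_pow]
  refine Finset.prod_eq_one fun j _ => ?_
  rw [← pow_mul, mul_comm, pow_mul, h.pow_left, one_pow]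

theorem commutator_dilate (h : IsCentralExponent q d) (s v : Fin n →₀ ℕ) :
    commutator q s (dilate d v) = 1 := by
  rw [commutator, qCocycle_dilate_left h, qCocycle_dilate_right h, div_one]

/-- The part of `f` supported on the exponents which commute with the indeterminates in the same
way as `s` does. -/
def isotypic (s : Fin n →₀ ℕ) (f : QPowerSeries q) : QPowerSeries q :=
  twist (fun t => open Classical in if ∀ i, commutator q (Finsupp.single i 1) t =
    commutator q (Finsupp.single i 1) s then 1 else 0) f

theorem coeff_isotypic_of_forall {s t : Fin n →₀ ℕ} (h : ∀ i,
    commutator q (Finsupp.single i 1) t = commutator q (Finsupp.single i 1) s)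
    (f : QPowerSeries q) : coeff t (isotypic s f) = coeff t f := by
  rw [isotypic, coeff_twist, if_pos h, one_mul]

theorem coeff_isotypic_of_not_forall {s t : Fin n →₀ ℕ} (h : ¬ ∀ i,
    commutator q (Finsupp.single i 1) t = commutator q (Finsupp.single i 1) s)
    (f : QPowerSeries q) : coeff t (isotypic s f) = 0 := by
  rw [isotypic, coeff_twist, if_neg h, zero_mul]

/-- The functions `w` such that an ideal is stable under `f ↦ twist w f`. -/
def twistStabilizer (A : TwoSidedIdeal (QPowerSeries q)) :
    Subalgebra k ((Fin n →₀ ℕ) → k) where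
  carrier := {w | ∀ f ∈ A, twist w f ∈ A}
  mul_mem' {v w} hv hw f hf := by
    have : twist (v * w) f = twist v (twist w f) := by
      ext s
      simp [coeff_twist, mul_assoc]
    rw [this]
    exact hv _ (hw _ hf)
  add_mem' {v w} hv hw f hf := by
    have : twist (v + w) f = twist v f + twist w f := by
      ext s
      simp [coeff_twist, coeff_add, add_mul]
    rw [this]
    exact A.add_mem (hv _ hf) (hw _ hf)
  algebraMap_mem' a f hf := by
    have : twist (algebraMap k _ a) f = monomial 0 a * f := by
      ext s
      rw [coeff_monomial_zero_mul, coeff_twist]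
      rfl
    rw [this]
    exact A.mul_mem_left _ _ hf

/-- An ideal stable under conjugation by the indeterminates contains the isotypic parts of its
elements. -/
theorem isotypic_mem (h : IsCentralExponent q d) (hq : IsMulAntisymm q)
    {A : TwoSidedIdeal (QPowerSeries q)}
    (hA : ∀ i, (fun t => (commutator q (Finsupp.single i 1) t : k)) ∈ twistStabilizer A)
    {f : QPowerSeries q} (hf : f ∈ A) (s : Fin n →₀ ℕ) : isotypic s f ∈ A := by
  classical
  -- An interpolation polynomial in the characters: it vanishes at exponents whose characters differ
  -- from those of `s`, and equals `w s ≠ 0` at the others. Dividing by `w s` gives the isotypic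
  -- projector.
  let w : (Fin n →₀ ℕ) → k := ∏ i, ∏ ω ∈ (Polynomial.nthRootsFinset (d i) (1 : k)).erase
    (commutator q (Finsupp.single i 1) s : k),
      ((fun t => (commutator q (Finsupp.single i 1) t : k)) - algebraMap k _ ω)
  have hw : w ∈ twistStabilizer A := prod_mem fun i _ => prod_mem fun ω _ =>
    sub_mem (hA i) (Subalgebra.algebraMap_mem _ _)
  have hwt : ∀ t, w t = ∏ i, ∏ ω ∈ (Polynomial.nthRootsFinset (d i) (1 : k)).erase
    (commutator q (Finsupp.single i 1) s : k),
      ((commutator q (Finsupp.single i 1) t : k) - ω) := by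
    intro t
    simp [w, Finset.prod_apply]
  have hws : w s ≠ 0 := by
    rw [hwt]
    refine Finset.prod_ne_zero_iff.2 fun i _ => Finset.prod_ne_zero_iff.2 fun ω hω => ?_
    exact sub_ne_zero.2 (Finset.ne_of_mem_erase hω).symm
  have : isotypic s f = monomial 0 (w s)⁻¹ * twist w f := by
    ext t
    rw [coeff_monomial_zero_mul, coeff_twist]
    by_cases ht : ∀ i, commutator q (Finsupp.single i 1) t = commutator q (Finsupp.single i 1) s
    · have : w t = w s := by
        rw [hwt, hwt]
        simp only [ht]
      rw [coeff_isotypic_of_forall ht, this, inv_mul_cancel_left₀ hws]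
    · rw [coeff_isotypic_of_not_forall ht]
      push Not at ht
      obtain ⟨i, hi⟩ := ht
      have : w t = 0 := by
        rw [hwt]
        refine Finset.prod_eq_zero (Finset.mem_univ i) (Finset.prod_eq_zero
          (i := (commutator q (Finsupp.single i 1) t : k)) ?_ (sub_self _))
        rw [Finset.mem_erase, Polynomial.mem_nthRootsFinset (h.pos i)]
        refine ⟨fun h' => hi (Units.ext h'), ?_⟩
        rw [← Units.val_pow_eq_pow_val, commutator_single_pow h hq, Units.val_one]
      rw [this, zero_mul, mul_zero]
  rw [this]
  exact A.mul_mem_left _ _ (hw f hf)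

theorem exists_eq_ofCenter (hd : ∀ i, 0 < d i) {f : QPowerSeries q}
    (hf : ∀ u, coeff u f ≠ 0 → ∀ i, d i ∣ u i) : ∃ g, f = ofCenter q d g := by
  refine ⟨MvPowerSeries.ofCoeff fun v => coeff (dilate d v) f, ?_⟩
  ext u
  by_cases hu : ∀ i, d i ∣ u i
  · obtain ⟨v, rfl⟩ := exists_eq_dilate hu
    rw [coeff_ofCenter_dilate hd, MvPowerSeries.coeff_ofCoeff]
  · rw [coeff_ofCenter_of_not_dvd _ hu]
    by_contra h
    exact hu (hf u h)

/-- A monomial multiple of an isotypic series is central. -/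
theorem exists_isotypic_mul_monomial_eq (h : IsCentralExponent q d) (hq : IsMulAntisymm q)
    (s : Fin n →₀ ℕ) (f : QPowerSeries q) :
    ∃ g, isotypic s f * monomial (dilate d s - s) 1 = ofCenter q d g := by
  refine exists_eq_ofCenter h.pos fun u hu => ?_
  rw [coeff_mul_monomial, ite_ne_right_iff] at hu
  obtain ⟨hle, hu⟩ := hu
  have h1 : ∀ i, commutator q (Finsupp.single i 1) (u - (dilate d s - s)) =
      commutator q (Finsupp.single i 1) s := by
    by_contra h'
    rw [coeff_isotypic_of_not_forall h'] at hu
    simp at hu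
  -- The exponent `u` has the same characters as `s + (dilate d s - s) = dilate d s`, which are
  -- trivial.
  refine h.dvd u fun i => ?_
  rw [← commutator_single hq, ← tsub_add_cancel_of_le hle, commutator_add_right, h1,
    ← commutator_add_right, add_tsub_cancel_of_le (le_dilate h.pos s), commutator_dilate h]

/-- Every monomial divides a central one, so cancelling monomials reduces to cancelling central
elements. -/
theorem monomial_mul_monomial_dilate_sub (h : IsCentralExponent q d) (t : Fin n →₀ ℕ) :
    ∃ a : k, a ≠ 0 ∧ (monomial t 1 * monomial (dilate d t - t) 1 : QPowerSeries q) =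
      ofCenter q d (MvPowerSeries.monomial t a) := by
  refine ⟨qCocycle q t (dilate d t - t) * (1 * 1), by simp, ?_⟩
  rw [monomial_mul_monomial, add_tsub_cancel_of_le (le_dilate h.pos t), ofCenter_monomial h.pos]

/-! ### Ideals generated by central elements -/

/-- The ideal `pR` generated by a central element `p`. -/
def centralIdeal (h : IsCentralExponent q d) (p : MvPowerSeries (Fin n) k) :
    TwoSidedIdeal (QPowerSeries q) :=
  TwoSidedIdeal.mk' {f | ∃ g, f = ofCenter q d p * g} ⟨0, (mul_zero _).symm⟩
    (fun {x y} ⟨a, ha⟩ ⟨b, hb⟩ => ⟨a + b, by rw [ha, hb, mul_add]⟩)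
    (fun {x} ⟨a, ha⟩ => ⟨-a, by rw [ha, mul_neg]⟩)
    (fun {x y} ⟨a, ha⟩ => ⟨x * a, by rw [ha, ← mul_assoc, mul_ofCenter_comm h, mul_assoc]⟩)
    (fun {x y} ⟨a, ha⟩ => ⟨a * y, by rw [ha, mul_assoc]⟩)

theorem mem_centralIdeal {h : IsCentralExponent q d} {p : MvPowerSeries (Fin n) k}
    {f : QPowerSeries q} : f ∈ centralIdeal h p ↔ ∃ g, f = ofCenter q d p * g :=
  TwoSidedIdeal.mem_mk' ..

/-- By freeness, divisibility by a central element is tested on coordinates. -/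
theorem mem_centralIdeal_iff_component {h : IsCentralExponent q d} {p : MvPowerSeries (Fin n) k}
    {f : QPowerSeries q} : f ∈ centralIdeal h p ↔ ∀ r : ∀ i, Fin (d i), p ∣ component f r := by
  rw [mem_centralIdeal]
  constructor
  · rintro ⟨g, rfl⟩ r
    rw [← mul_ofCenter_comm h, component_mul_ofCenter h]
    exact dvd_mul_left _ _
  · intro hf
    choose c hc using hf
    obtain ⟨g, rfl⟩ := component_surjective (q := q) h.pos c
    refine ⟨g, ?_⟩
    apply component_injective h.pos
    funext r
    rw [← mul_ofCenter_comm h, component_mul_ofCenter h, hc, mul_comm]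

theorem mem_centralIdeal_of_mul_ofCenter {h : IsCentralExponent q d}
    {p m : MvPowerSeries (Fin n) k} (hp : Prime p) (hm : ¬ p ∣ m) {f : QPowerSeries q}
    (hf : f * ofCenter q d m ∈ centralIdeal h p) : f ∈ centralIdeal h p := by
  rw [mem_centralIdeal_iff_component] at hf ⊢
  intro r
  have := hf r
  rw [component_mul_ofCenter h] at this
  exact (hp.dvd_or_dvd this).resolve_right hm

theorem mem_centralIdeal_of_mul_monomial {h : IsCentralExponent q d}
    {p : MvPowerSeries (Fin n) k} (hp : Prime p) (hX : ∀ i, ¬ p ∣ MvPowerSeries.X i)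
    {f : QPowerSeries q} (t : Fin n →₀ ℕ) (hf : f * monomial t 1 ∈ centralIdeal h p) :
    f ∈ centralIdeal h p := by
  obtain ⟨a, ha, hat⟩ := monomial_mul_monomial_dilate_sub h t
  refine mem_centralIdeal_of_mul_ofCenter hp
    (MvPowerSeries.not_prime_dvd_monomial hp hX t ha) ?_
  rw [← hat, ← mul_assoc]
  exact TwoSidedIdeal.mul_mem_right _ _ _ hf

theorem component_isotypic (h : IsCentralExponent q d) (f : QPowerSeries q)
    (r : ∀ i, Fin (d i)) : component (isotypic (residueExponent r) f) r = component f r := by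
  ext v
  rw [coeff_component, coeff_component, coeff_isotypic_of_forall]
  intro i
  rw [commutator_add_right, commutator_dilate h, mul_one]

/-- Monomials are cancellable modulo `pR`, so the ideal of all `a` with `aRb ⊆ pR` is stable under
conjugation by the `xᵢ`. If it contains some `a` outside `pR`, an isotypic part of `a` yields a
central element of it not divisible by `p`; cancelling that element puts `b` in `pR`. -/
theorem isPrimeTwoSided_centralIdeal (h : IsCentralExponent q d) (hq : IsMulAntisymm q)
    {p : MvPowerSeries (Fin n) k} (hp : Prime p) (hX : ∀ i, ¬ p ∣ MvPowerSeries.X i) :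
    IsPrimeTwoSided (centralIdeal h p) := by
  refine ⟨fun htop => ?_, fun a b hab => ?_⟩
  · have h1 : (1 : QPowerSeries q) ∈ centralIdeal h p := htop ▸ trivial
    obtain ⟨g, hg⟩ := mem_centralIdeal.1 h1
    have h2 := isUnit_iff.1 (IsUnit.of_mul_eq_one _ hg.symm)
    rw [← dilate_zero d, coeff_ofCenter_dilate h.pos,
      MvPowerSeries.coeff_zero_eq_constantCoeff_apply] at h2
    exact hp.not_isUnit (MvPowerSeries.isUnit_iff_constantCoeff.2 (isUnit_iff_ne_zero.2 h2))
  · by_contra! hcon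
    obtain ⟨ha, hb⟩ := hcon
    let I := centralIdeal h p
    let A : TwoSidedIdeal (QPowerSeries q) := TwoSidedIdeal.mk' {a | ∀ r, a * r * b ∈ I}
      (fun r => by rw [zero_mul, zero_mul]; exact I.zero_mem)
      (fun {x y} hx hy r => by rw [add_mul, add_mul]; exact I.add_mem (hx r) (hy r))
      (fun {x} hx r => by rw [neg_mul, neg_mul]; exact I.neg_mem (hx r))
      (fun {x y} hy r => by rw [mul_assoc x, mul_assoc x]; exact I.mul_mem_left _ _ (hy r))
      (fun {x y} hx r => by rw [mul_assoc x]; exact hx _)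
    have hAmem : ∀ a, a ∈ A ↔ ∀ r, a * r * b ∈ I := fun a => TwoSidedIdeal.mem_mk' ..
    have hA : ∀ i, (fun t => (commutator q (Finsupp.single i 1) t : k)) ∈ twistStabilizer A := by
      intro i f hf
      rw [hAmem]
      intro r
      obtain ⟨c, hc, hct⟩ := monomial_mul_monomial_dilate_sub h (Finsupp.single i 1)
      refine mem_centralIdeal_of_mul_ofCenter hp
        (MvPowerSeries.not_prime_dvd_monomial hp hX (Finsupp.single i 1) hc) ?_
      -- Here `xᵢ f xᵢ^(dᵢ-1) r b` is the twist of `f` times the central `c xᵢ^(dᵢ)` times `r b`,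
      -- and this central factor can be cancelled.
      have h1 := (hAmem _).1 (A.mul_mem_left (monomial (Finsupp.single i 1) 1) _ hf)
        (monomial (dilate d (Finsupp.single i 1) - Finsupp.single i 1) 1 * r)
      rw [monomial_mul_eq, mul_assoc (twist _ f), ← mul_assoc (monomial _ _), hct] at h1
      rw [mul_ofCenter_comm h, ← mul_assoc, ← mul_assoc, ← mul_ofCenter_comm h, mul_assoc (twist _ f)]
      exact h1
    obtain ⟨r, hr⟩ : ∃ r : ∀ i, Fin (d i), ¬ p ∣ component a r := by
      rw [mem_centralIdeal_iff_component] at ha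
      push Not at ha
      exact ha
    have h1 := isotypic_mem h hq hA ((hAmem a).2 hab) (residueExponent r)
    obtain ⟨g, hg⟩ := exists_isotypic_mul_monomial_eq h hq (residueExponent r) a
    have h2 := A.mul_mem_right _ (monomial (dilate d (residueExponent r) - residueExponent r) 1) h1
    rw [hg, hAmem] at h2
    have h3 := h2 1
    rw [mul_one, ← mul_ofCenter_comm h] at h3
    refine hb (mem_centralIdeal_of_mul_ofCenter hp ?_ h3)
    -- If `p` divided the central element, cancelling the monomial would put the isotypic part in
    -- `pR`, although it has the same component at `r` as `a`.
    rintro ⟨c, rfl⟩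
    refine hr ?_
    rw [← component_isotypic h]
    have h4 : isotypic (residueExponent r) a ∈ centralIdeal h p :=
      mem_centralIdeal_of_mul_monomial hp hX _
        (mem_centralIdeal.2 ⟨ofCenter q d c, hg.trans ((centerHom h).map_mul p c)⟩)
    exact mem_centralIdeal_iff_component.1 h4 r

/-! ### The ideals generated by the indeterminates -/

/-- The ideal of the series all of whose terms are divisible by `xᵢ`. -/
def variableIdeal (q : Fin n → Fin n → kˣ) (i : Fin n) : TwoSidedIdeal (QPowerSeries q) :=
  TwoSidedIdeal.mk' {f | ∀ s : Fin n →₀ ℕ, s i = 0 → coeff s f = 0} (fun _ _ => rfl)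
    (fun {x y} hx hy s hs => by rw [coeff_add, hx s hs, hy s hs, add_zero])
    (fun {x} hx s hs => by rw [coeff_neg, hx s hs, neg_zero])
    (fun {x y} hy s hs => by
      rw [coeff_mul]
      refine Finset.sum_eq_zero fun p hp => ?_
      rw [Finset.HasAntidiagonal.mem_antidiagonal] at hp
      have := DFunLike.congr_fun hp i
      rw [Finsupp.add_apply, hs, Nat.add_eq_zero_iff] at this
      rw [hy _ this.2, mul_zero, mul_zero])
    (fun {x y} hx s hs => by
      rw [coeff_mul]
      refine Finset.sum_eq_zero fun p hp => ?_
      rw [Finset.HasAntidiagonal.mem_antidiagonal] at hp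
      have := DFunLike.congr_fun hp i
      rw [Finsupp.add_apply, hs, Nat.add_eq_zero_iff] at this
      rw [hx _ this.1, zero_mul, mul_zero])

theorem mem_variableIdeal {i : Fin n} {f : QPowerSeries q} :
    f ∈ variableIdeal q i ↔ ∀ s : Fin n →₀ ℕ, s i = 0 → coeff s f = 0 :=
  TwoSidedIdeal.mem_mk' ..

theorem mem_variableIdeal_iff_exists_X_mul {i : Fin n} {f : QPowerSeries q} :
    f ∈ variableIdeal q i ↔ ∃ g, f = X q i * g := by
  rw [mem_variableIdeal]
  have hle : ∀ s : Fin n →₀ ℕ, Finsupp.single i 1 ≤ s ↔ s i ≠ 0 := fun s => by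
    rw [Finsupp.single_le_iff, Nat.one_le_iff_ne_zero]
  constructor
  · intro hf
    refine ⟨mk fun u => ((qCocycle q (Finsupp.single i 1) u)⁻¹ : kˣ) *
      coeff (u + Finsupp.single i 1) f, ?_⟩
    ext s
    rw [X, coeff_monomial_mul]
    split_ifs with hs
    · rw [coeff_mk, tsub_add_cancel_of_le hs]
      simp
    · exact hf s (not_not.1 fun h => hs ((hle s).2 h))
  · rintro ⟨g, rfl⟩ s hs
    rw [X, coeff_monomial_mul, if_neg]
    rw [hle]
    simpa using hs

theorem mem_variableIdeal_iff_exists_mul_X {i : Fin n} {f : QPowerSeries q} :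
    f ∈ variableIdeal q i ↔ ∃ g, f = g * X q i := by
  rw [mem_variableIdeal_iff_exists_X_mul]
  constructor
  · rintro ⟨g, rfl⟩
    exact ⟨_, monomial_mul_eq _ _ _⟩
  · rintro ⟨g, rfl⟩
    exact ⟨_, mul_monomial_eq _ _ _⟩

/-- Series outside the ideal have a term on the face `sᵢ = 0`, and such series are closed under
multiplication. -/
theorem isPrimeTwoSided_variableIdeal (i : Fin n) : IsPrimeTwoSided (variableIdeal q i) := by
  refine ⟨fun htop => ?_, fun a b hab => ?_⟩
  · have h1 : (1 : QPowerSeries q) ∈ variableIdeal q i := htop ▸ trivial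
    have := mem_variableIdeal.1 h1 0 rfl
    rw [coeff_one, if_pos rfl] at this
    exact one_ne_zero this
  · by_contra! h
    simp only [mem_variableIdeal] at h
    push Not at h
    obtain ⟨s, hs, hs'⟩ := exists_coeff_mul_ne_zero (F := fun s => s i = 0)
      (fun s t => by simp) h.1 h.2
    have := mem_variableIdeal.1 (hab 1) s hs
    rw [mul_one] at this
    exact hs' this

theorem X_ne_zero (i : Fin n) : X q i ≠ 0 :=
  ne_zero_iff.2 ⟨Finsupp.single i 1, by simp [X, coeff_monomial]⟩

/-! ### Prime ideals -/

/-- A prime ideal not containing `xᵢ` is stable under conjugation by `xᵢ`. -/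
theorem commutator_mem_twistStabilizer {P : TwoSidedIdeal (QPowerSeries q)}
    (hP : IsPrimeTwoSided P) {i : Fin n} (hi : X q i ∉ P) :
    (fun t => (commutator q (Finsupp.single i 1) t : k)) ∈ twistStabilizer P := by
  intro f hf
  -- With `f'` the twist of `f` and `r xᵢ = xᵢ r'`, one has `f' r xᵢ = f' xᵢ r' = xᵢ f r' ∈ P`.
  refine (hP.2 _ (X q i) fun r => ?_).resolve_right hi
  rw [mul_assoc, X, mul_monomial_eq, ← mul_assoc, ← monomial_mul_eq]
  exact P.mul_mem_right _ _ (P.mul_mem_left _ _ hf)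

theorem monomial_eq_mul_monomial_one (s : Fin n →₀ ℕ) (a : k) :
    (monomial s a : QPowerSeries q) = monomial 0 a * monomial s 1 := by
  rw [monomial_mul_monomial, zero_add, qCocycle_zero_left, Units.val_one, one_mul, mul_one]

/-- Normality of `xᵢ` gives `xᵢ R xᵢ^m ⊆ R xᵢ^(m+1)`, so primeness lowers the exponent. -/
theorem X_mem_of_monomial_mem {P : TwoSidedIdeal (QPowerSeries q)}
    (hP : IsPrimeTwoSided P) {i : Fin n} (m : ℕ)
    (h : (monomial (Finsupp.single i m) 1 : QPowerSeries q) ∈ P) : X q i ∈ P := by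
  induction m with
  | zero =>
    rw [Finsupp.single_zero] at h
    have h1 : (1 : QPowerSeries q) ∈ P := h
    exact mul_one (X q i) ▸ P.mul_mem_left _ _ h1
  | succ m ih =>
    refine (hP.2 (X q i) (monomial (Finsupp.single i m) 1) fun r => ?_).elim id ih
    rw [X, monomial_mul_eq, mul_assoc, monomial_mul_monomial, add_comm, ← Finsupp.single_add]
    rw [monomial_eq_mul_monomial_one]
    exact P.mul_mem_left _ _ (P.mul_mem_left _ _ h)

/-- A nonzero prime ideal not containing any indeterminate contains a prime element of the centre
not dividing any indeterminate. -/
theorem exists_prime_ofCenter_mem [Infinite k] (h : IsCentralExponent q d) (hq : IsMulAntisymm q)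
    {P : TwoSidedIdeal (QPowerSeries q)} (hP : IsPrimeTwoSided P) (hne : P ≠ ⊥)
    (hX : ∀ i, X q i ∉ P) : ∃ p : MvPowerSeries (Fin n) k,
      Prime p ∧ (∀ i, ¬ p ∣ MvPowerSeries.X i) ∧ ofCenter q d p ∈ P := by
  obtain ⟨f, hf, hf0⟩ : ∃ f ∈ P, f ≠ 0 := by
    by_contra! h'
    exact hne (le_bot_iff.1 fun f hf => (TwoSidedIdeal.mem_bot _).2 (h' f hf))
  obtain ⟨s, hs⟩ := ne_zero_iff.1 hf0
  have h1 := isotypic_mem h hq (fun i => commutator_mem_twistStabilizer hP (hX i)) hf s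
  obtain ⟨g, hg⟩ := exists_isotypic_mul_monomial_eq h hq s f
  have h2 := P.mul_mem_right _ (monomial (dilate d s - s) 1) h1
  rw [hg] at h2
  have hg0 : g ≠ 0 := by
    rintro rfl
    rw [← centerHom_apply h, map_zero, mul_eq_zero] at hg
    refine hg.elim (fun h3 => hs ?_) (fun h3 => ?_)
    · rw [← coeff_isotypic_of_forall (fun _ => rfl) f, h3, coeff_zero]
    · have := congrArg (coeff (dilate d s - s)) h3
      rw [coeff_monomial, if_pos rfl, coeff_zero] at this
      exact one_ne_zero this
  -- The contraction of `P` to the central subring, which is prime and contains `g ≠ 0`.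
  let I : Ideal (MvPowerSeries (Fin n) k) :=
    { carrier := {g | ofCenter q d g ∈ P}
      zero_mem' := by
        change centerHom h 0 ∈ P
        rw [map_zero]
        exact P.zero_mem
      add_mem' := fun {a b} ha hb => by
        change centerHom h (a + b) ∈ P
        rw [map_add]
        exact P.add_mem ha hb
      smul_mem' := fun a b hb => by
        change centerHom h (a * b) ∈ P
        rw [map_mul]
        exact P.mul_mem_left _ _ hb }
  have hI : I.IsPrime := by
    refine ⟨fun htop => hP.1 ?_, fun {a b} hab => ?_⟩
    · have h3 : centerHom h 1 ∈ P := (Ideal.eq_top_iff_one I).1 htop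
      rw [map_one] at h3
      exact top_le_iff.1 fun x _ => mul_one x ▸ P.mul_mem_left _ _ h3
    · refine hP.2 (ofCenter q d a) (ofCenter q d b) fun r => ?_
      rw [← mul_ofCenter_comm h, mul_assoc]
      refine P.mul_mem_left _ _ ?_
      have h3 : centerHom h (a * b) ∈ P := hab
      rwa [map_mul] at h3
  obtain ⟨p, hpI, hp⟩ := UniqueFactorizationMonoid.iff_exists_prime_mem_of_isPrime.1
    (inferInstance : UniqueFactorizationMonoid (MvPowerSeries (Fin n) k)) I
    (fun hbot => hg0 (by
      have : g ∈ I := h2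
      rwa [hbot] at this)) hI
  -- The variable `X i` of the central ring is `xᵢ^(dᵢ)`; were it in `P`, so would be `xᵢ`.
  refine ⟨p, hp, fun i hi => hX i ?_, hpI⟩
  have h3 : ofCenter q d (MvPowerSeries.X i) ∈ P := I.mem_of_dvd hi hpI
  rw [MvPowerSeries.X, ofCenter_monomial h.pos] at h3
  have h4 : dilate d (Finsupp.single i 1) = Finsupp.single i (d i) := by
    ext j
    by_cases hj : i = j
    · subst hj
      simp [dilate_apply]
    · simp [dilate_apply, hj]
  rw [h4] at h3
  exact X_mem_of_monomial_mem hP _ h3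

theorem isPrincipalTwoSided_of_isHeightOnePrime [Infinite k] (h : IsCentralExponent q d)
    (hq : IsMulAntisymm q) {P : TwoSidedIdeal (QPowerSeries q)} (hP : IsHeightOnePrime P) :
    IsPrincipalTwoSided P := by
  by_cases hX : ∀ i, X q i ∉ P
  · obtain ⟨p, hp, hpX, hpP⟩ := exists_prime_ofCenter_mem h hq hP.choose hP.ne_bot hX
    have heq : centralIdeal h p = P := by
      refine hP.eq_of_le isPrimeTwoSided_bot (isPrimeTwoSided_centralIdeal h hq hp hpX) ?_ ?_
      · intro hbot
        have h1 : ofCenter q d p ∈ centralIdeal h p := mem_centralIdeal.2 ⟨1, (mul_one _).symm⟩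
        rw [hbot, TwoSidedIdeal.mem_bot] at h1
        exact hp.ne_zero (centerHom_injective h (h1.trans (map_zero _).symm))
      · intro f hf
        obtain ⟨g, rfl⟩ := mem_centralIdeal.1 hf
        exact P.mul_mem_right _ _ hpP
    refine ⟨ofCenter q d p, fun x => ?_, fun x => ?_⟩
    · rw [← heq, mem_centralIdeal]
    · rw [← heq, mem_centralIdeal]
      simp only [mul_ofCenter_comm h]
  · push Not at hX
    obtain ⟨i, hi⟩ := hX
    have heq : variableIdeal q i = P := by
      refine hP.eq_of_le isPrimeTwoSided_bot (isPrimeTwoSided_variableIdeal i) ?_ ?_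
      · intro hbot
        have h1 : X q i ∈ variableIdeal q i :=
          mem_variableIdeal_iff_exists_X_mul.2 ⟨1, (mul_one _).symm⟩
        rw [hbot, TwoSidedIdeal.mem_bot] at h1
        exact X_ne_zero i h1
      · intro f hf
        obtain ⟨g, rfl⟩ := mem_variableIdeal_iff_exists_X_mul.1 hf
        exact P.mul_mem_right _ _ hi
    refine ⟨X q i, fun x => ?_, fun x => ?_⟩
    · rw [← heq, mem_variableIdeal_iff_exists_X_mul]
    · rw [← heq, mem_variableIdeal_iff_exists_mul_X]

theorem isUFR [Infinite k] (h : IsCentralExponent q d) (hq : IsMulAntisymm q) :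
    IsUFR (QPowerSeries q) where
  left_noetherian := isNoetherianRing h
  right_noetherian := isNoetherianRing_mulOpposite h
  prime := isPrimeTwoSided_bot
  principal _ := isPrincipalTwoSided_of_isHeightOnePrime h hq

/-- If they commuted, cancelling `xᵢ` would give `xⱼ = qᵢⱼ xⱼ`. -/
theorem X_mul_X_ne (hq : IsMulAntisymm q) {i j : Fin n} (hij : q i j ≠ 1) :
    X q i * X q j ≠ X q j * X q i := by
  intro h
  have h1 : X q i * X q j = twist (fun t => (commutator q (Finsupp.single i 1) t : k)) (X q j) *
    X q i := monomial_mul_eq _ _ _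
  rw [h] at h1
  have h2 := congrArg (coeff (Finsupp.single j 1)) (mul_right_cancel₀ (X_ne_zero i) h1)
  rw [coeff_twist, X, coeff_monomial, if_pos rfl, commutator_single hq,
    Finset.prod_eq_single j (fun b _ hb => by simp [hb.symm]) (by simp)] at h2
  apply hij
  ext
  simpa using h2.symm

end QPowerSeries

/-! ### From the basis of the radical to the theorem -/

/-- A positive diagonal basis of the radical gives the exponents of the centre. -/
theorem exists_isCentralExponent {k : Type*} [Field k] {n : ℕ} {q : Fin n → Fin n → kˣ}
    (hq : IsMulAntisymm q)
    (hS : ∃ b : Module.Basis (Fin n) ℤ (qRadical q), IsPositiveDiagonal b) :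
    ∃ d : Fin n → ℕ, IsCentralExponent q d := by
  obtain ⟨b, hb0, hbpos⟩ := hS
  have hd : ∀ i, (((b i : Fin n → ℤ) i).toNat : ℤ) = (b i : Fin n → ℤ) i :=
    fun i => Int.toNat_of_nonneg (hbpos i).le
  have hpow : ∀ i j, q i j ^ ((b i : Fin n → ℤ) i).toNat = 1 := by
    intro i j
    -- Since `b i` is supported at `i`, pairing it with the `j`-th unit vector leaves `q i j ^ d i`.
    have h1 : qBicharacter q (b i) (Pi.single j 1) = 1 := (b i).2 (Pi.single j 1)
    rw [qBicharacter, Finset.prod_eq_single i, Finset.prod_eq_single j] at h1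
    · rw [Pi.single_eq_same, mul_one, ← hd, zpow_natCast] at h1
      exact h1
    · intro a _ ha
      rw [Pi.single_eq_of_ne ha, mul_zero, zpow_zero]
    · simp
    · intro a _ ha
      refine Finset.prod_eq_one fun c _ => ?_
      rw [hb0 i a ha.symm, zero_mul, zpow_zero]
    · simp
  refine ⟨fun i => ((b i : Fin n → ℤ) i).toNat, ?_, hpow, fun i j => ?_, fun s hs i => ?_⟩
  · intro i
    have := hbpos i
    omega
  · rw [hq.2 i j, inv_pow, hpow, inv_one]
  · have hmem : (fun i => (s i : ℤ)) ∈ qRadical q := by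
      intro t
      rw [qBicharacter, Finset.prod_comm]
      refine Finset.prod_eq_one fun j _ => ?_
      have h1 : ∏ i, q i j ^ s i = 1 := by
        rw [← inv_eq_one, ← hs j, ← Finset.prod_inv_distrib]
        refine Finset.prod_congr rfl fun i _ => ?_
        rw [hq.2 i j, inv_pow, inv_inv]
      simp only [zpow_mul, zpow_natCast, Finset.prod_zpow, h1, one_zpow]
    -- In the expansion of `s` in the diagonal basis only `b i` contributes to the `i`-th
    -- coordinate.
    have h1 := congrArg Subtype.val (b.sum_repr ⟨_, hmem⟩)
    have h2 := congrFun h1 i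
    simp only [AddSubgroup.val_finsetSum, AddSubgroup.coe_zsmul, Finset.sum_apply, Pi.smul_apply,
      smul_eq_mul] at h2
    rw [Finset.sum_eq_single i (fun j _ hj => by rw [hb0 j i hj, mul_zero]) (by simp)] at h2
    zify
    rw [hd, ← h2]
    exact dvd_mul_left _ _

end

theorem corollary4p2 {k : Type*} [Field k] [IsAlgClosed k] {n : ℕ} (hn : 0 < n)
    (q : Fin n → Fin n → kˣ) (hq : IsMulAntisymm q)
    (hroot : ∀ i j, IsOfFinOrder (q i j))
    (hS : ∃ b : Module.Basis (Fin n) ℤ (qRadical q), IsPositiveDiagonal b) :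
    IsUFR (QPowerSeries q) ∧
    IsDomain (QPowerSeries q) ∧
    IsLocalRing (QPowerSeries q) ∧
    (∀ f : QPowerSeries q, f ∈ QPowerSeries.augIdeal q ↔ ¬ IsUnit f) ∧
    IsSeparatedComplete (QPowerSeries.augIdeal q) ∧
    IsPIAlgebra k (QPowerSeries q) ∧
    ((∃ i j, q i j ≠ 1) → ∃ f g : QPowerSeries q, f * g ≠ g * f) := by
  obtain ⟨d, hd⟩ := exists_isCentralExponent hq hS
  have : Infinite k := IsAlgClosed.instInfinite
  exact ⟨QPowerSeries.isUFR hd hq, inferInstance, inferInstance,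
    fun _ => QPowerSeries.mem_augIdeal_iff_not_isUnit, QPowerSeries.isSeparatedComplete_augIdeal,
    QPowerSeries.isPIAlgebra hd, fun ⟨_, _, h⟩ => ⟨_, _, QPowerSeries.X_mul_X_ne hq h⟩⟩
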